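/- Let $d\ge 1$ be an integer, $0<s<1$, $p\ge 1$, and let $\alpha,\beta\in\mathbb R$ satisfy $\alpha,\ \beta,\ \alpha+\beta\in(-1,sp)$ and $1+\alpha+\beta\ne sp$. Let $\mathbb R^d_+=\{x\in\mathbb R^d: x_d>0\}$, and let $C_c(\mathbb R^d_+)$ be the set of continuous functions $u:\mathbb R^d_+\to\mathbb R$ with compact support in $\mathbb R^d_+$. Put $$\mathcal D=\frac{\pi^{\frac{d-1}{2}}\,\Gamma\left(\frac{1+sp}{2}\right)}{\Gamma\left(\frac{d+sp}{2}\right)}\int_0^1\frac{(t^\alpha+t^\beta)\,\bigl|1-t^{-\frac{1+\alpha+\beta-sp}{p}}\bigr|^p}{(1-t)^{1+sp}}\,dt .$$ Then this integral converges, $\mathcal D>0$, and for all $u\in C_c(\mathbb R^d_+)$ $$\int_{\mathbb R^d_+}\int_{\mathbb R^d_+}\frac{|u(x)-u(y)|^p}{|x-y|^{d+sp}}\,x_d^\alpha\,y_d^\beta\,dy\,dx\ \ge\ \mathcal D\int_{\mathbb R^d_+}\frac{|u(x)|^p}{x_d^{sp-\alpha-\beta}}\,dx ,$$ where the left-hand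 side may be $+\infty$. The constant $\mathcal D$ is optimal: if $C\in\mathbb R$ is such that the inequality with $C$ in place of $\mathcal D$ holds for all $u\in C_c(\mathbb R^d_+)$, then $C\le\mathcal D$. -/

import Mathlib

open MeasureTheory

noncomputable section

/-- The last coordinate `x_d` of a point `x` of `ℝ^d`, `d ≥ 1`. -/
def lastCoord {d : ℕ} [NeZero d] (x : EuclideanSpace ℝ (Fin d)) : ℝ :=
  x ⟨d - 1, Nat.sub_one_lt (NeZero.ne d)⟩

/-- The open half-space `{x ∈ ℝ^d : x_d > 0}`. -/
def halfSpace (d : ℕ) [NeZero d] : Set (EuclideanSpace ℝ (Fin d)) :=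
  {x | 0 < lastCoord x}

/-- The class `C_c(Ω)` of continuous real functions with compact support contained in `Ω`
(extended by zero to the whole space). -/
def Cc {E : Type*} [TopologicalSpace E] (Ω : Set E) : Set (E → ℝ) :=
  {u | Continuous u ∧ HasCompactSupport u ∧ tsupport u ⊆ Ω}

/-- The weighted double integral
`∫∫ |u(x) - u(y)|^p / |x - y|^(d+sp) * x_d^α * y_d^β dy dx` over the half-space, with values
in `[0, ∞]`. -/
def weightedEnergy (d : ℕ) [NeZero d] (s p α β : ℝ) (u : EuclideanSpace ℝ (Fin d) → ℝ) :
    ENNReal :=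
  ∫⁻ x in halfSpace d, ∫⁻ y in halfSpace d,
    ENNReal.ofReal
      (|u x - u y| ^ p / ‖x - y‖ ^ ((d : ℝ) + s * p) * lastCoord x ^ α * lastCoord y ^ β)

/-- The Hardy integral `∫ |u(x)|^p / x_d^(sp-α-β) dx` over the half-space, with values
in `[0, ∞]`. -/
def hardyIntegral (d : ℕ) [NeZero d] (s p α β : ℝ) (u : EuclideanSpace ℝ (Fin d) → ℝ) :
    ENNReal :=
  ∫⁻ x in halfSpace d, ENNReal.ofReal (|u x| ^ p / lastCoord x ^ (s * p - α - β))

/-- The integrand in the definition of the constant. -/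
def hardyConstIntegrand (s p α β t : ℝ) : ℝ :=
  (t ^ α + t ^ β) * |1 - t ^ (-((1 + α + β - s * p) / p))| ^ p / (1 - t) ^ (1 + s * p)

/-- The constant `𝒟(d, s, p, α, β)`. -/
def hardyConst (d : ℕ) (s p α β : ℝ) : ℝ :=
  Real.pi ^ (((d : ℝ) - 1) / 2) * Real.Gamma ((1 + s * p) / 2)
    / Real.Gamma (((d : ℝ) + s * p) / 2)
    * ∫ t in (0 : ℝ)..1, hardyConstIntegrand s p α β t

end

section

open Set
open scoped ENNReal

/-! Write `d = m + 1`, `x = (x', x_d)`, and let `γ p = 1 + α + β - s p`. Symmetrising reduces the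
energy to pairs with `y_d < x_d`. For these put `y = x - x_d η`, where `η` runs over the slab `0 <
η_d < 1`, and `t = 1 - η_d`. For fixed `η` the map `x ↦ x - x_d η` (`shear`) preserves the measure
`x_d⁻¹ dx` (`measurePreserving_shear`). With `v = x_d^γ u` all powers of `x_d` are absorbed: the
Hardy integral is `‖v‖^p` in `L^p(x_d⁻¹ dx)`, and the energy is the integral over the slab of
`|η|^(-(d+sp)) (t^α + t^β) ‖v - t^(-γ) v ∘ shear η‖^p` (`weightedEnergy_eq`).

The composition is an isometry of `L^p`, so the triangle inequality bounds the last norm below by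
`|1 - t^(-γ)| ‖v‖` (`abs_one_sub_rpow_mul_lintegral_le`). Integrating the remaining weight over the
hyperplanes `η_d = const` gives exactly the constant (`setLIntegral_slab_hardyConstIntegrand`),
which proves the inequality.

The bound is sharp if some `v` are almost invariant under all shears. They exist for a structural
reason: identifying the half-space with the group law `(z, r)(ζ, t) = (z + r ζ, r t)`, the shears
are right translations of a solvable, hence amenable, group. Explicitly, `v` is a product of tents
in `log x_d` and `x'` at scales `n` and `n e^n` (`exists_lintegral_cutoff_sub_shear_le`), and `u =
x_d^(-γ) v` is tested as `n → ∞`. -/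

/-- Real version of the convergence of the beta integral. -/
theorem intervalIntegrable_rpow_mul_one_sub_rpow {a b : ℝ} (ha : -1 < a) (hb : -1 < b) :
    IntervalIntegrable (fun t : ℝ => t ^ a * (1 - t) ^ b) volume 0 1 := by
  have h := (Complex.betaIntegral_convergent (u := ((a + 1 : ℝ) : ℂ)) (v := ((b + 1 : ℝ) : ℂ))
    (by simpa using by linarith) (by simpa using by linarith)).norm
  rw [intervalIntegrable_iff_integrableOn_Ioo_of_le zero_le_one] at h ⊢
  refine h.congr_fun (fun t ht => ?_) measurableSet_Ioo
  have h1 : (1 : ℂ) - t = ((1 - t : ℝ) : ℂ) := by push_cast; ring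
  have h2 : 0 < 1 - t := by linarith [ht.2]
  simp only [norm_mul, h1]
  rw [Complex.norm_cpow_eq_rpow_re_of_pos ht.1, Complex.norm_cpow_eq_rpow_re_of_pos h2]
  simp

/-! ### The Gamma factor of the constant, from Gaussian integrals. -/

theorem lintegral_rpow_mul_exp_neg_mul_Ioi {a r : ℝ} (ha : 0 < a) (hr : 0 < r) :
    ∫⁻ t in Ioi (0 : ℝ), ENNReal.ofReal (t ^ (a - 1) * Real.exp (-(r * t))) =
      ENNReal.ofReal ((1 / r) ^ a * Real.Gamma a) := by
  have hval := Real.integral_rpow_mul_exp_neg_mul_Ioi ha hr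
  have hG := Real.Gamma_pos_of_pos ha
  rw [← hval, ofReal_integral_eq_lintegral_ofReal]
  · apply Integrable.of_integral_ne_zero
    rw [hval]; positivity
  · filter_upwards [ae_restrict_mem measurableSet_Ioi] with t ht
    have : 0 < t := ht
    simp only [Pi.zero_apply]; positivity

theorem lintegral_exp_neg_mul_sq_norm (m : ℕ) {b : ℝ} (hb : 0 < b) :
    ∫⁻ z : EuclideanSpace ℝ (Fin m), ENNReal.ofReal (Real.exp (-b * ‖z‖ ^ 2)) =
      ENNReal.ofReal ((Real.pi / b) ^ ((m : ℝ) / 2)) := by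
  have hval := GaussianFourier.integral_rexp_neg_mul_sq_norm (V := EuclideanSpace ℝ (Fin m)) hb
  rw [finrank_euclideanSpace_fin] at hval
  rw [← hval, ofReal_integral_eq_lintegral_ofReal]
  · apply Integrable.of_integral_ne_zero
    rw [hval]; have := Real.pi_pos; positivity
  · exact Filter.Eventually.of_forall fun z => (Real.exp_pos _).le

/-- The constant `π^((d-1)/2) Γ((1+σ)/2) / Γ((d+σ)/2)`. -/
noncomputable def sliceConst (d : ℕ) (σ : ℝ) : ℝ :=
  Real.pi ^ (((d : ℝ) - 1) / 2) * Real.Gamma ((1 + σ) / 2) / Real.Gamma (((d : ℝ) + σ) / 2)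

theorem sliceConst_pos (m : ℕ) {σ : ℝ} (hσ : -1 < σ) : 0 < sliceConst (m + 1) σ := by
  have h1 := Real.Gamma_pos_of_pos (s := (1 + σ) / 2) (by linarith)
  have h2 := Real.Gamma_pos_of_pos (s := (((m + 1 : ℕ) : ℝ) + σ) / 2)
    (by push_cast; have : (0 : ℝ) ≤ m := m.cast_nonneg; linarith)
  have := Real.pi_pos
  unfold sliceConst
  positivity

/-- The integral of `(1 + ‖z‖²)^(-(m+1+σ)/2)` over `ℝ^m`. -/
theorem lintegral_one_add_norm_sq_rpow_neg (m : ℕ) {σ : ℝ} (hσ : -1 < σ) :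
    ∫⁻ z : EuclideanSpace ℝ (Fin m),
        ENNReal.ofReal ((1 + ‖z‖ ^ 2) ^ (-((((m + 1 : ℕ) : ℝ) + σ) / 2))) =
      ENNReal.ofReal (sliceConst (m + 1) σ) := by
  unfold sliceConst
  set a : ℝ := (((m + 1 : ℕ) : ℝ) + σ) / 2 with ha_def
  have hm : (0 : ℝ) ≤ m := m.cast_nonneg
  have ha : 0 < a := by rw [ha_def]; push_cast; linarith
  have hG := Real.Gamma_pos_of_pos ha
  have hpi := Real.pi_pos
  have hG0 : ENNReal.ofReal (Real.Gamma a) ≠ 0 := by simpa using hG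
  -- `Γ(a) (1 + ‖z‖²)^(-a)` is a Laplace integral in `r`; after exchanging the integrals the one in
  -- `z` is Gaussian, and another Gamma integral remains.
  have key : ENNReal.ofReal (Real.Gamma a) * ∫⁻ z : EuclideanSpace ℝ (Fin m),
      ENNReal.ofReal ((1 + ‖z‖ ^ 2) ^ (-a)) =
      ENNReal.ofReal (Real.pi ^ ((m : ℝ) / 2) * Real.Gamma ((1 + σ) / 2)) := by
    calc _ = ∫⁻ z : EuclideanSpace ℝ (Fin m), ∫⁻ r in Ioi (0 : ℝ),
          ENNReal.ofReal (r ^ (a - 1) * Real.exp (-((1 + ‖z‖ ^ 2) * r))) := by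
          rw [← lintegral_const_mul _ (by fun_prop)]
          refine lintegral_congr fun z => ?_
          have hz : 0 < 1 + ‖z‖ ^ 2 := by positivity
          rw [lintegral_rpow_mul_exp_neg_mul_Ioi ha hz, ← ENNReal.ofReal_mul hG.le,
            mul_comm, one_div, Real.inv_rpow hz.le, Real.rpow_neg hz.le]
      _ = ∫⁻ r in Ioi (0 : ℝ), ∫⁻ z : EuclideanSpace ℝ (Fin m),
          ENNReal.ofReal (r ^ (a - 1) * Real.exp (-((1 + ‖z‖ ^ 2) * r))) := by
          rw [lintegral_lintegral_swap]
          apply Measurable.aemeasurable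
          fun_prop
      _ = ∫⁻ r in Ioi (0 : ℝ), ENNReal.ofReal (Real.pi ^ ((m : ℝ) / 2)) *
          ENNReal.ofReal (r ^ ((1 + σ) / 2 - 1) * Real.exp (-(1 * r))) := by
          refine setLIntegral_congr_fun measurableSet_Ioi fun r hr => ?_
          have hr : 0 < r := hr
          have h1 : ∀ z : EuclideanSpace ℝ (Fin m),
              ENNReal.ofReal (r ^ (a - 1) * Real.exp (-((1 + ‖z‖ ^ 2) * r))) =
              ENNReal.ofReal (r ^ (a - 1) * Real.exp (-r)) *
                ENNReal.ofReal (Real.exp (-r * ‖z‖ ^ 2)) := by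
            intro z
            rw [← ENNReal.ofReal_mul (by positivity), mul_assoc, ← Real.exp_add]
            congr 3; ring
          simp only [h1]
          rw [lintegral_const_mul _ (by fun_prop), lintegral_exp_neg_mul_sq_norm m hr,
            ← ENNReal.ofReal_mul (by positivity), ← ENNReal.ofReal_mul (by positivity),
            Real.div_rpow hpi.le hr.le]
          congr 1
          have h2 : (1 + σ) / 2 - 1 = (a - 1) - m / 2 := by rw [ha_def]; push_cast; ring
          rw [h2, Real.rpow_sub hr (a - 1)]
          simp only [one_mul, div_eq_mul_inv]
          generalize r ^ (a - 1) = y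
          ac_rfl
      _ = _ := by
          rw [lintegral_const_mul _ (by fun_prop),
            lintegral_rpow_mul_exp_neg_mul_Ioi (by linarith) one_pos,
            ← ENNReal.ofReal_mul (by positivity)]
          simp
  have h3 : ((((m + 1 : ℕ) : ℝ) - 1) / 2) = (m : ℝ) / 2 := by push_cast; ring
  rw [h3, ENNReal.ofReal_div_of_pos hG, ← key, mul_comm,
    ENNReal.mul_div_cancel_right hG0 ENNReal.ofReal_ne_top]

/-! ### Splitting off the last coordinate. -/

theorem lintegral_comp_smul_addHaar {E : Type*} [NormedAddCommGroup E] [NormedSpace ℝ E]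
    [MeasurableSpace E] [BorelSpace E] [FiniteDimensional ℝ E] (μ : Measure E)
    [μ.IsAddHaarMeasure] {r : ℝ} (hr : 0 < r) (f : E → ℝ≥0∞) :
    ∫⁻ x, f x ∂μ = ENNReal.ofReal (r ^ Module.finrank ℝ E) * ∫⁻ x, f (r • x) ∂μ := by
  have h := lintegral_map_equiv (μ := μ) f (MeasurableEquiv.smul₀ r hr.ne')
  have h2 : (⇑(MeasurableEquiv.smul₀ r hr.ne') : E → E) = fun x => r • x := rfl
  rw [h2, Measure.map_addHaar_smul μ hr.ne', lintegral_smul_measure] at h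
  rw [← h, smul_eq_mul, ← mul_assoc, ← ENNReal.ofReal_mul (by positivity),
    abs_of_pos (by positivity), mul_inv_cancel₀ (by positivity)]
  simp

/-- The first `m` coordinates of a point of `ℝ^(m+1)`. -/
noncomputable def initCoord {m : ℕ} (x : EuclideanSpace ℝ (Fin (m + 1))) :
    EuclideanSpace ℝ (Fin m) :=
  WithLp.toLp 2 fun j => x j.castSucc

theorem lastCoord_eq {m : ℕ} (x : EuclideanSpace ℝ (Fin (m + 1))) :
    lastCoord x = x (Fin.last m) := rfl

theorem norm_sq_eq_lastCoord_add_initCoord {m : ℕ} (x : EuclideanSpace ℝ (Fin (m + 1))) :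
    ‖x‖ ^ 2 = lastCoord x ^ 2 + ‖initCoord x‖ ^ 2 := by
  rw [EuclideanSpace.norm_sq_eq, EuclideanSpace.norm_sq_eq, Fin.sum_univ_castSucc, add_comm]
  simp [initCoord, lastCoord_eq]

theorem measurePreserving_lastCoord_initCoord (m : ℕ) :
    MeasurePreserving (fun x : EuclideanSpace ℝ (Fin (m + 1)) => (lastCoord x, initCoord x)) := by
  have h1 := PiLp.volume_preserving_ofLp (Fin (m + 1))
  have h2 := volume_preserving_piFinSuccAbove (fun _ : Fin (m + 1) => ℝ) (Fin.last m)
  have h3 := (MeasurePreserving.id (volume : Measure ℝ)).prod (PiLp.volume_preserving_toLp (Fin m))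
  have h4 := h3.comp (h2.comp h1)
  convert h4 using 1
  · funext x
    simp [initCoord, lastCoord_eq, MeasurableEquiv.piFinSuccAbove]
    rfl
  · rfl

@[fun_prop]
theorem measurable_lastCoord {d : ℕ} [NeZero d] :
    Measurable (lastCoord : EuclideanSpace ℝ (Fin d) → ℝ) := by
  unfold lastCoord; fun_prop

@[fun_prop]
theorem continuous_lastCoord {d : ℕ} [NeZero d] :
    Continuous (lastCoord : EuclideanSpace ℝ (Fin d) → ℝ) := by
  unfold lastCoord; fun_prop

@[fun_prop]
theorem measurable_initCoord {m : ℕ} :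
    Measurable (initCoord : EuclideanSpace ℝ (Fin (m + 1)) → _) := by
  unfold initCoord; fun_prop

@[fun_prop]
theorem continuous_initCoord {m : ℕ} :
    Continuous (initCoord : EuclideanSpace ℝ (Fin (m + 1)) → _) := by
  unfold initCoord; fun_prop

theorem lintegral_slice {m : ℕ} {f : ℝ → EuclideanSpace ℝ (Fin m) → ℝ≥0∞}
    (hf : Measurable (Function.uncurry f)) :
    ∫⁻ x : EuclideanSpace ℝ (Fin (m + 1)), f (lastCoord x) (initCoord x) =
      ∫⁻ r, ∫⁻ z, f r z := by
  have h := lintegral_prod (μ := volume) (ν := volume) _ hf.aemeasurable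
  simp only [Function.uncurry_apply_pair] at h
  rw [← h]
  exact (measurePreserving_lastCoord_initCoord m).lintegral_comp hf

theorem measurableSet_halfSpace (d : ℕ) [NeZero d] : MeasurableSet (halfSpace d) :=
  measurableSet_lt measurable_const measurable_lastCoord

/-- The slab `{0 < η_d < 1}`. -/
def slab (m : ℕ) : Set (EuclideanSpace ℝ (Fin (m + 1))) := {η | lastCoord η ∈ Ioo (0 : ℝ) 1}

theorem measurableSet_slab (m : ℕ) : MeasurableSet (slab m) :=
  measurable_lastCoord measurableSet_Ioo

theorem setLIntegral_lastCoord_preimage {m : ℕ} {f : ℝ → EuclideanSpace ℝ (Fin m) → ℝ≥0∞}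
    (hf : Measurable (Function.uncurry f)) {A : Set ℝ} (hA : MeasurableSet A) :
    ∫⁻ x : EuclideanSpace ℝ (Fin (m + 1)) in lastCoord ⁻¹' A, f (lastCoord x) (initCoord x) =
      ∫⁻ r in A, ∫⁻ z, f r z := by
  rw [← lintegral_indicator (measurable_lastCoord hA), ← lintegral_indicator hA]
  have h := lintegral_slice (f := fun r z => A.indicator (fun r => f r z) r) (m := m) (by
    have : (Function.uncurry fun r z => A.indicator (fun r => f r z) r) =
        (Prod.fst ⁻¹' A).indicator (Function.uncurry f) := by
      ext ⟨r, z⟩; simp only [indicator]; rfl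
    rw [this]; exact hf.indicator (measurable_fst hA))
  rw [show (lastCoord ⁻¹' A).indicator (fun x => f (lastCoord x) (initCoord x)) =
    fun x => A.indicator (fun r => f r (initCoord x)) (lastCoord x) by
      ext x; simp only [indicator]; rfl, h]
  refine lintegral_congr fun r => ?_
  by_cases hr : r ∈ A <;> simp [hr]

/-- On the slice `η_d = r` the substitution `z = r w` takes `r^(-(m+1+σ))` out of the norm and
contributes the Jacobian `r^m`, hence the weight `r^(-(1+σ))`. The integral left over does not
depend on `r`. -/
theorem setLIntegral_slab {m : ℕ} {σ : ℝ} (hσ : -1 < σ) {G : ℝ → ℝ≥0∞} (hG : Measurable G) :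
    ∫⁻ η in slab m, ENNReal.ofReal (‖η‖ ^ (-(((m + 1 : ℕ) : ℝ) + σ))) * G (lastCoord η) =
      ENNReal.ofReal (sliceConst (m + 1) σ) *
        ∫⁻ r in Ioo (0 : ℝ) 1, ENNReal.ofReal (r ^ (-(1 + σ))) * G r := by
  set b : ℝ := ((m + 1 : ℕ) : ℝ) + σ with hb
  have hnorm : ∀ η : EuclideanSpace ℝ (Fin (m + 1)),
      ‖η‖ ^ (-b) = (lastCoord η ^ 2 + ‖initCoord η‖ ^ 2) ^ (-(b / 2)) := by
    intro η
    rw [← norm_sq_eq_lastCoord_add_initCoord, ← Real.rpow_natCast, ← Real.rpow_mul (norm_nonneg _)]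
    congr 1; push_cast; ring
  simp only [hnorm]
  have h := setLIntegral_lastCoord_preimage (m := m)
    (f := fun r z => ENNReal.ofReal ((r ^ 2 + ‖z‖ ^ 2) ^ (-(b / 2))) * G r)
    (by
      apply Measurable.mul
      · fun_prop
      · exact hG.comp measurable_fst) (A := Ioo 0 1) measurableSet_Ioo
  change ∫⁻ x in lastCoord ⁻¹' Ioo 0 1, _ = _
  rw [h, ← lintegral_const_mul _ (by fun_prop)]
  refine setLIntegral_congr_fun measurableSet_Ioo fun r hr => ?_
  have hr0 : 0 < r := hr.1
  rw [lintegral_mul_const _ (by fun_prop), lintegral_comp_smul_addHaar volume hr0,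
    finrank_euclideanSpace_fin, ← mul_assoc]
  congr 1
  have h1 : ∀ z : EuclideanSpace ℝ (Fin m),
      ENNReal.ofReal ((r ^ 2 + ‖r • z‖ ^ 2) ^ (-(b / 2))) =
      ENNReal.ofReal (r ^ (-b)) * ENNReal.ofReal ((1 + ‖z‖ ^ 2) ^ (-(b / 2))) := by
    intro z
    rw [← ENNReal.ofReal_mul (by positivity), norm_smul, Real.norm_of_nonneg hr0.le,
      show r ^ 2 + (r * ‖z‖) ^ 2 = r ^ 2 * (1 + ‖z‖ ^ 2) by ring,
      Real.mul_rpow (by positivity) (by positivity), ← Real.rpow_natCast r 2,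
      ← Real.rpow_mul hr0.le]
    congr 3; push_cast; ring
  simp only [h1]
  rw [lintegral_const_mul _ (by fun_prop), lintegral_one_add_norm_sq_rpow_neg m hσ, ← mul_assoc,
    mul_comm]
  congr 1
  rw [← ENNReal.ofReal_mul (by positivity), ← Real.rpow_natCast, ← Real.rpow_add hr0]
  congr 2; rw [hb]; push_cast; ring

/-! ### Shears, their invariant measure, and the change of variables. -/

theorem lastCoord_sub {d : ℕ} [NeZero d] (x y : EuclideanSpace ℝ (Fin d)) :
    lastCoord (x - y) = lastCoord x - lastCoord y := rfl

theorem lastCoord_smul {d : ℕ} [NeZero d] (r : ℝ) (y : EuclideanSpace ℝ (Fin d)) :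
    lastCoord (r • y) = r * lastCoord y := rfl

/-- The linear map `x ↦ x - x_d η`. -/
noncomputable def shear {m : ℕ} (η x : EuclideanSpace ℝ (Fin (m + 1))) :
    EuclideanSpace ℝ (Fin (m + 1)) :=
  x - lastCoord x • η

theorem lastCoord_shear {m : ℕ} (η x : EuclideanSpace ℝ (Fin (m + 1))) :
    lastCoord (shear η x) = (1 - lastCoord η) * lastCoord x := by
  rw [shear, lastCoord_sub, lastCoord_smul]; ring

theorem initCoord_shear {m : ℕ} (η x : EuclideanSpace ℝ (Fin (m + 1))) :
    initCoord (shear η x) = initCoord x - lastCoord x • initCoord η := rfl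

theorem measurable_shear_uncurry {m : ℕ} :
    Measurable (fun q : EuclideanSpace ℝ (Fin (m + 1)) × EuclideanSpace ℝ (Fin (m + 1)) =>
      shear q.1 q.2) := by
  unfold shear; fun_prop

@[fun_prop]
theorem measurable_shear {m : ℕ} (η : EuclideanSpace ℝ (Fin (m + 1))) : Measurable (shear η) := by
  unfold shear; fun_prop

/-- The measure `x_d⁻¹ dx` on the half-space. -/
noncomputable def halfMeasure (m : ℕ) : Measure (EuclideanSpace ℝ (Fin (m + 1))) :=
  (volume.restrict (halfSpace (m + 1))).withDensity fun x => ENNReal.ofReal (lastCoord x)⁻¹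

theorem lintegral_halfMeasure {m : ℕ} {f : EuclideanSpace ℝ (Fin (m + 1)) → ℝ≥0∞}
    (hf : Measurable f) :
    ∫⁻ x, f x ∂halfMeasure m =
      ∫⁻ x in halfSpace (m + 1), ENNReal.ofReal (lastCoord x)⁻¹ * f x := by
  rw [halfMeasure, lintegral_withDensity_eq_lintegral_mul _ (by fun_prop) hf]
  rfl

/-- The shear is a transvection along `-η`, so its determinant is `1 - η_d`. -/
theorem lintegral_comp_shear {m : ℕ} {η : EuclideanSpace ℝ (Fin (m + 1))} (hη : η ∈ slab m)
    {f : EuclideanSpace ℝ (Fin (m + 1)) → ℝ≥0∞} (hf : Measurable f) :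
    ∫⁻ x, f (shear η x) = ENNReal.ofReal (1 - lastCoord η)⁻¹ * ∫⁻ x, f x := by
  have ht : 0 < 1 - lastCoord η := by linarith [hη.2]
  let lc : Module.Dual ℝ (EuclideanSpace ℝ (Fin (m + 1))) :=
    { toFun := lastCoord, map_add' := fun _ _ => rfl, map_smul' := fun _ _ => rfl }
  have hT : ∀ x, LinearMap.transvection lc (-η) x = shear η x := by
    intro x
    change x + lastCoord x • (-η) = x - lastCoord x • η
    rw [smul_neg, sub_eq_add_neg]
  have hdet : LinearMap.det (LinearMap.transvection lc (-η)) = 1 - lastCoord η := by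
    rw [LinearMap.transvection.det, map_neg]; rfl
  have hmap := Measure.map_linearMap_addHaar_eq_smul_addHaar
    (volume : Measure (EuclideanSpace ℝ (Fin (m + 1)))) (f := LinearMap.transvection lc (-η))
    (by rw [hdet]; exact ht.ne')
  rw [hdet, abs_of_pos (inv_pos.2 ht), show ⇑(LinearMap.transvection lc (-η)) = shear η from
    funext hT] at hmap
  rw [← lintegral_map hf (measurable_shear η), hmap, lintegral_smul_measure, smul_eq_mul]

/-- The shear multiplies `x_d` by `1 - η_d`, which is also its determinant; the density `x_d⁻¹`
compensates exactly for the Jacobian. -/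
theorem measurePreserving_shear {m : ℕ} {η : EuclideanSpace ℝ (Fin (m + 1))} (hη : η ∈ slab m) :
    MeasurePreserving (shear η) (halfMeasure m) (halfMeasure m) := by
  have ht : 0 < 1 - lastCoord η := by linarith [hη.2]
  have key : ∀ f : EuclideanSpace ℝ (Fin (m + 1)) → ℝ≥0∞, Measurable f →
      ∫⁻ x, f (shear η x) ∂halfMeasure m = ∫⁻ x, f x ∂halfMeasure m := by
    intro f hf
    rw [lintegral_halfMeasure hf, lintegral_halfMeasure (by fun_prop),
      ← lintegral_indicator (measurableSet_halfSpace _),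
      ← lintegral_indicator (measurableSet_halfSpace _)]
    have h := lintegral_comp_shear hη (f := (halfSpace (m + 1)).indicator fun x =>
      ENNReal.ofReal (lastCoord x)⁻¹ * f x)
      (Measurable.indicator (by fun_prop) (measurableSet_halfSpace _))
    have h2 : ∀ x, (halfSpace (m + 1)).indicator (fun x =>
        ENNReal.ofReal (lastCoord x)⁻¹ * f x) (shear η x) = ENNReal.ofReal (1 - lastCoord η)⁻¹ *
        (halfSpace (m + 1)).indicator (fun x =>
          ENNReal.ofReal (lastCoord x)⁻¹ * f (shear η x)) x := by
      intro x
      by_cases hx : x ∈ halfSpace (m + 1)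
      · have hx' : 0 < lastCoord x := hx
        have hx2 : shear η x ∈ halfSpace (m + 1) := by
          change 0 < lastCoord (shear η x); rw [lastCoord_shear]; positivity
        rw [indicator_of_mem hx, indicator_of_mem hx2, lastCoord_shear, mul_inv,
          ENNReal.ofReal_mul (by positivity), mul_assoc]
      · have hx2 : shear η x ∉ halfSpace (m + 1) := by
          intro h
          apply hx
          change 0 < lastCoord _ at h
          rw [lastCoord_shear] at h
          exact pos_of_mul_pos_right h ht.le
        rw [indicator_of_notMem hx, indicator_of_notMem hx2, mul_zero]
    simp only [h2] at h
    rw [lintegral_const_mul] at h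
    · exact (ENNReal.mul_right_inj (by simpa using ht) ENNReal.ofReal_ne_top).1 h
    · exact Measurable.indicator (by fun_prop) (measurableSet_halfSpace _)
  refine ⟨measurable_shear η, Measure.ext fun A hA => ?_⟩
  have h := key (A.indicator 1) (measurable_one.indicator hA)
  rw [lintegral_indicator_one hA] at h
  rw [Measure.map_apply (measurable_shear η) hA, ← h,
    ← lintegral_indicator_one (measurable_shear η hA)]
  rfl

theorem ae_lastCoord_ne (m : ℕ) (c : ℝ) :
    ∀ᵐ y : EuclideanSpace ℝ (Fin (m + 1)), lastCoord y ≠ c := by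
  have h := (measurePreserving_lastCoord_initCoord m).measure_preimage
    (s := {c} ×ˢ univ) ((measurableSet_singleton c).prod .univ).nullMeasurableSet
  rw [Measure.volume_eq_prod, Measure.prod_prod, Real.volume_singleton, zero_mul] at h
  rw [ae_iff]
  convert h using 2
  ext y; simp

/-- Double integrals over the half-space, symmetrised and written in terms of `y = x - x_d η`. -/
theorem lintegral_halfSpace_halfSpace {m : ℕ}
    {k : EuclideanSpace ℝ (Fin (m + 1)) → EuclideanSpace ℝ (Fin (m + 1)) → ℝ≥0∞}
    (hk : Measurable (Function.uncurry k)) :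
    ∫⁻ x in halfSpace (m + 1), ∫⁻ y in halfSpace (m + 1), k x y =
      ∫⁻ η in slab m, ∫⁻ x in halfSpace (m + 1),
        ENNReal.ofReal (lastCoord x ^ (m + 1)) * (k x (shear η x) + k (shear η x) x) := by
  let E := EuclideanSpace ℝ (Fin (m + 1))
  -- Up to the null set `x_d = y_d`, the double integral is that of `k` over `A` plus that of `k`
  -- over the transpose of `A`; exchanging the variables turns the latter into an integral of the
  -- transposed kernel over `A`.
  let A : Set (E × E) := {q | 0 < lastCoord q.2 ∧ lastCoord q.2 < lastCoord q.1}
  have hfst : Measurable fun q : E × E => lastCoord q.1 := by fun_prop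
  have hsnd : Measurable fun q : E × E => lastCoord q.2 := by fun_prop
  have hA : MeasurableSet A :=
    (measurableSet_lt measurable_const hsnd).inter (measurableSet_lt hsnd hfst)
  have hk' : Measurable (Function.uncurry fun x y => k y x) := hk.comp measurable_swap
  let F₁ : E → E → ℝ≥0∞ := fun x y => A.indicator (Function.uncurry k) (x, y)
  let F₂ : E → E → ℝ≥0∞ := fun x y => A.indicator (Function.uncurry fun x y => k y x) (x, y)
  have hF₁ : Measurable (Function.uncurry F₁) := hk.indicator hA
  have hF₂ : Measurable (Function.uncurry F₂) := hk'.indicator hA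
  have hx₁ : ∀ x, Measurable (F₁ x) := fun x => hF₁.comp measurable_prodMk_left
  have hsplit : ∀ x ∈ halfSpace (m + 1),
      ∫⁻ y in halfSpace (m + 1), k x y = ∫⁻ y, (F₁ x y + F₂ y x) := by
    intro x hx
    rw [← lintegral_indicator (measurableSet_halfSpace _)]
    refine lintegral_congr_ae ?_
    filter_upwards [ae_lastCoord_ne m (lastCoord x)] with y hy
    have hx' : 0 < lastCoord x := hx
    by_cases hy0 : 0 < lastCoord y
    · rcases lt_or_gt_of_ne hy with h | h
      · simp [F₁, F₂, A, indicator, halfSpace, hy0, h, h.not_gt]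
      · simp [F₁, F₂, A, indicator, halfSpace, hy0, h, h.not_gt, hx']
    · have h1 : ¬ (lastCoord x < lastCoord y) := by linarith
      simp [F₁, F₂, A, indicator, halfSpace, hy0, h1]
  have hzero : ∀ x ∉ halfSpace (m + 1), ∀ y, F₁ x y = 0 ∧ F₂ x y = 0 ∧ F₂ y x = 0 := by
    intro x hx y
    have hx' : lastCoord x ≤ 0 := not_lt.1 hx
    have h1 : ¬ (0 < lastCoord y ∧ lastCoord y < lastCoord x) := by
      rintro ⟨a, b⟩; linarith
    have h2 : ¬ (0 < lastCoord x ∧ lastCoord x < lastCoord y) := by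
      rintro ⟨a, b⟩; linarith
    simp only [F₁, F₂, A, indicator, mem_ofPred_eq, h1, h2, if_false, and_self]
  calc ∫⁻ x in halfSpace (m + 1), ∫⁻ y in halfSpace (m + 1), k x y
      = ∫⁻ x, ∫⁻ y, (F₁ x y + F₂ y x) := by
        rw [← lintegral_indicator (measurableSet_halfSpace _)]
        refine lintegral_congr fun x => ?_
        by_cases hx : x ∈ halfSpace (m + 1)
        · rw [indicator_of_mem hx, hsplit x hx]
        · rw [indicator_of_notMem hx]
          simp [hzero x hx]
    _ = (∫⁻ x, ∫⁻ y, F₁ x y) + ∫⁻ x, ∫⁻ y, F₂ y x := by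
        rw [← lintegral_add_left (Measurable.lintegral_prod_right hF₁)]
        exact lintegral_congr fun x => lintegral_add_left (hx₁ x) _
    _ = (∫⁻ x, ∫⁻ y, F₁ x y) + ∫⁻ x, ∫⁻ y, F₂ x y := by
        rw [lintegral_lintegral_swap (f := F₂) hF₂.aemeasurable]
    _ = ∫⁻ x, ∫⁻ y, (F₁ x y + F₂ x y) := by
        rw [← lintegral_add_left (Measurable.lintegral_prod_right hF₁)]
        exact lintegral_congr fun x => (lintegral_add_left (hx₁ x) _).symm
    _ = ∫⁻ x in halfSpace (m + 1), ∫⁻ y, (F₁ x y + F₂ x y) := by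
        rw [← lintegral_indicator (measurableSet_halfSpace _)]
        refine lintegral_congr fun x => ?_
        by_cases hx : x ∈ halfSpace (m + 1)
        · rw [indicator_of_mem hx]
        · rw [indicator_of_notMem hx]
          simp [hzero x hx]
    _ = ∫⁻ x in halfSpace (m + 1), ∫⁻ η in slab m,
        ENNReal.ofReal (lastCoord x ^ (m + 1)) * (k x (shear η x) + k (shear η x) x) := by
        refine setLIntegral_congr_fun (measurableSet_halfSpace _) fun x hx => ?_
        have hx' : 0 < lastCoord x := hx
        -- Substitution `y = x - x_d η` at fixed `x`: a reflected translation followed by a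
        -- dilation, which gives the factor `x_d^(m+1)`.
        rw [← lintegral_sub_left_eq_self _ x, lintegral_comp_smul_addHaar volume hx',
          finrank_euclideanSpace_fin, ← lintegral_indicator (measurableSet_slab _),
          ← lintegral_const_mul' _ _ ENNReal.ofReal_ne_top]
        refine lintegral_congr fun η => ?_
        have hiff : (x, x - lastCoord x • η) ∈ A ↔ η ∈ slab m := by
          change (0 < lastCoord (shear η x) ∧ lastCoord (shear η x) < lastCoord x) ↔
            (0 < lastCoord η ∧ lastCoord η < 1)
          rw [lastCoord_shear]
          constructor
          · rintro ⟨h1, h2⟩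
            have := pos_of_mul_pos_left h1 hx'.le
            constructor <;> nlinarith
          · rintro ⟨h1, h2⟩
            constructor <;> nlinarith
        by_cases hη : η ∈ slab m
        · have h := hiff.2 hη
          rw [indicator_of_mem hη]
          simp only [F₁, F₂]
          rw [indicator_of_mem h, indicator_of_mem h]
          rfl
        · have h := fun h' => hη (hiff.1 h')
          rw [indicator_of_notMem hη]
          simp only [F₁, F₂]
          rw [indicator_of_notMem h, indicator_of_notMem h]
          simp
    _ = _ := by
        rw [lintegral_lintegral_swap]
        apply Measurable.aemeasurable
        have h1 : Measurable fun q : E × E => (q.1, shear q.2 q.1) :=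
          measurable_fst.prodMk (measurable_shear_uncurry.comp measurable_swap)
        exact Measurable.mul (by fun_prop) ((hk.comp h1).add (hk'.comp h1))

/-! ### The Hardy inequality. -/

theorem eLpNorm_ofReal_rpow {X : Type*} [MeasurableSpace X] (μ : Measure X) {p : ℝ} (hp : 0 < p)
    (f : X → ℝ) :
    eLpNorm f (ENNReal.ofReal p) μ ^ p = ∫⁻ x, ENNReal.ofReal (|f x| ^ p) ∂μ := by
  rw [eLpNorm_eq_lintegral_rpow_enorm_toReal (by simpa using hp) ENNReal.ofReal_ne_top,
    ENNReal.toReal_ofReal hp.le, ← ENNReal.rpow_mul, one_div, inv_mul_cancel₀ hp.ne',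
    ENNReal.rpow_one]
  refine lintegral_congr fun x => ?_
  rw [← ENNReal.ofReal_rpow_of_nonneg (abs_nonneg _) hp.le, ← Real.norm_eq_abs,
    ofReal_norm]

/-- The reverse Minkowski inequality for `v - τ (v ∘ T)` with `T` measure preserving. -/
theorem abs_one_sub_rpow_mul_lintegral_le {X : Type*} [MeasurableSpace X] {μ : Measure X}
    {T : X → X} (hT : MeasurePreserving T μ μ) {p τ : ℝ} (hp : 1 ≤ p) (hτ : 0 ≤ τ)
    {v : X → ℝ} (hv : Measurable v) (hfin : ∫⁻ x, ENNReal.ofReal (|v x| ^ p) ∂μ ≠ ∞) :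
    ENNReal.ofReal (|1 - τ| ^ p) * ∫⁻ x, ENNReal.ofReal (|v x| ^ p) ∂μ ≤
      ∫⁻ x, ENNReal.ofReal (|v x - τ * v (T x)| ^ p) ∂μ := by
  have hp0 : 0 < p := by linarith
  have hq : 1 ≤ ENNReal.ofReal p := by simpa using hp
  set w : X → ℝ := fun x => τ * v (T x) with hw
  have hwm : Measurable w := (hv.comp hT.measurable).const_mul τ
  rw [← eLpNorm_ofReal_rpow μ hp0, ← eLpNorm_ofReal_rpow μ hp0 (fun x => v x - w x)]
  rw [← eLpNorm_ofReal_rpow μ hp0] at hfin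
  set a := eLpNorm v (ENNReal.ofReal p) μ with ha
  have haf : a ≠ ∞ := fun h => hfin (by rw [h, ENNReal.top_rpow_of_pos hp0])
  have hb : eLpNorm w (ENNReal.ofReal p) μ = ENNReal.ofReal τ * a := by
    have : w = τ • (v ∘ T) := rfl
    rw [this, eLpNorm_const_smul, eLpNorm_comp_measurePreserving hv.aestronglyMeasurable hT,
      Real.enorm_eq_ofReal hτ]
  set c := eLpNorm (fun x => v x - w x) (ENNReal.ofReal p) μ with hc
  have h1 : a ≤ c + ENNReal.ofReal τ * a := by
    rw [← hb]
    have := eLpNorm_add_le (μ := μ) (f := fun x => v x - w x) (g := w)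
      (hv.sub hwm).aestronglyMeasurable hwm.aestronglyMeasurable hq
    convert this using 2
    ext x; simp
  have h2 : ENNReal.ofReal τ * a ≤ a + c := by
    rw [← hb]
    have := eLpNorm_sub_le (μ := μ) (f := v) (g := fun x => v x - w x)
      hv.aestronglyMeasurable (hv.sub hwm).aestronglyMeasurable hq
    convert this using 2
    ext x; simp
  -- For `τ ≤ 1` use `v = (v - w) + w`, for `τ ≥ 1` use `w = v - (v - w)`. Finiteness of `a` permits
  -- the cancellation in `[0, ∞]`.
  have key : ENNReal.ofReal |1 - τ| * a ≤ c := by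
    rcases le_total τ 1 with h | h
    · rw [abs_of_nonneg (by linarith)]
      have : a = ENNReal.ofReal (1 - τ) * a + ENNReal.ofReal τ * a := by
        rw [← add_mul, ← ENNReal.ofReal_add (by linarith) hτ]; simp
      refine (ENNReal.add_le_add_iff_right
        (ENNReal.mul_ne_top (ENNReal.ofReal_ne_top (r := τ)) haf)).1 ?_
      rw [← this]; exact h1
    · rw [abs_of_nonpos (by linarith)]
      have : ENNReal.ofReal τ * a = a + ENNReal.ofReal (-(1 - τ)) * a := by
        nth_rw 2 [← one_mul a]
        rw [← ENNReal.ofReal_one, ← add_mul, ← ENNReal.ofReal_add (by linarith) (by linarith)]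
        congr 2; ring
      refine (ENNReal.add_le_add_iff_left haf).1 ?_
      rw [← this]; exact h2
  rw [← ENNReal.ofReal_rpow_of_nonneg (abs_nonneg _) hp0.le, ← ENNReal.mul_rpow_of_nonneg _ _ hp0.le]
  exact ENNReal.rpow_le_rpow key hp0.le

/-- The Jacobian `x_d^(m+1)`, the kernel `x_d^(-(m+1+sp))` and the weights `x_d^(α+β)` multiply to
`x_d⁻¹ x_d^(γp)`. The two orders of `x` and `y` contribute `t^β` and `t^α`. The factor `t^(-γ)`
appears because `x_d^γ` is evaluated at the sheared point. -/
theorem weightedEnergy_eq {m : ℕ} {s p α β γ : ℝ} (hγ : γ * p = 1 + α + β - s * p)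
    {u : EuclideanSpace ℝ (Fin (m + 1)) → ℝ} (hu : Measurable u) :
    weightedEnergy (m + 1) s p α β u =
      ∫⁻ η in slab m, ENNReal.ofReal (‖η‖ ^ (-(((m + 1 : ℕ) : ℝ) + s * p))) *
        ENNReal.ofReal ((1 - lastCoord η) ^ α + (1 - lastCoord η) ^ β) *
        ∫⁻ x, ENNReal.ofReal (|lastCoord x ^ γ * u x - (1 - lastCoord η) ^ (-γ) *
          (lastCoord (shear η x) ^ γ * u (shear η x))| ^ p) ∂halfMeasure m := by
  rw [weightedEnergy, lintegral_halfSpace_halfSpace]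
  · refine setLIntegral_congr_fun (measurableSet_slab m) fun η hη => ?_
    have h0 : 0 < lastCoord η := hη.1
    have ht : 0 < 1 - lastCoord η := by linarith [hη.2]
    have hη0 : 0 < ‖η‖ := by
      rw [norm_pos_iff]; rintro rfl
      simp [lastCoord] at h0
    rw [lintegral_halfMeasure (by fun_prop), ← lintegral_const_mul _ (by fun_prop)]
    refine setLIntegral_congr_fun (measurableSet_halfSpace _) fun x hx => ?_
    have hX : 0 < lastCoord x := hx
    rw [norm_sub_rev (shear η x) x, abs_sub_comm (u (shear η x)),
      show x - shear η x = lastCoord x • η by rw [shear]; abel, norm_smul,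
      Real.norm_of_nonneg hX.le, lastCoord_shear]
    set X := lastCoord x
    set t := 1 - lastCoord η
    set A := |u x - u (shear η x)|
    have hv : |X ^ γ * u x - t ^ (-γ) * ((t * X) ^ γ * u (shear η x))| ^ p =
        X ^ (γ * p) * A ^ p := by
      rw [Real.mul_rpow ht.le hX.le, Real.rpow_neg ht.le,
        show X ^ γ * u x - (t ^ γ)⁻¹ * (t ^ γ * X ^ γ * u (shear η x)) =
          X ^ γ * (u x - u (shear η x)) by
          have : t ^ γ ≠ 0 := (Real.rpow_pos_of_pos ht γ).ne'
          field_simp,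
        abs_mul, abs_of_pos (Real.rpow_pos_of_pos hX γ),
        Real.mul_rpow (by positivity) (by positivity), ← Real.rpow_mul hX.le]
    rw [hv, ← ENNReal.ofReal_add (by positivity) (by positivity),
      ← ENNReal.ofReal_mul (by positivity), ← ENNReal.ofReal_mul (by positivity),
      ← ENNReal.ofReal_mul (by positivity), ← ENNReal.ofReal_mul (by positivity)]
    congr 1
    rw [hγ, Real.mul_rpow hX.le hη0.le, Real.mul_rpow ht.le hX.le, Real.mul_rpow ht.le hX.le,
      Real.rpow_neg hη0.le]
    have e1 : X ^ (1 + α + β - s * p) = X * X ^ α * X ^ β / X ^ (s * p) := by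
      rw [Real.rpow_sub hX, Real.rpow_add hX, Real.rpow_add hX, Real.rpow_one]
    have e2 : X ^ (((m + 1 : ℕ) : ℝ) + s * p) = X ^ (m + 1) * X ^ (s * p) := by
      rw [Real.rpow_add hX, Real.rpow_natCast]
    rw [e1, e2]
    have e3 : X ^ (s * p) ≠ 0 := (Real.rpow_pos_of_pos hX _).ne'
    have e4 : ‖η‖ ^ (((m + 1 : ℕ) : ℝ) + s * p) ≠ 0 := (Real.rpow_pos_of_pos hη0 _).ne'
    field_simp
    rw [add_comm]
  · have : Measurable fun q : EuclideanSpace ℝ (Fin (m + 1)) × EuclideanSpace ℝ (Fin (m + 1)) =>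
        ENNReal.ofReal (|u q.1 - u q.2| ^ p / ‖q.1 - q.2‖ ^ (((m + 1 : ℕ) : ℝ) + s * p) *
          lastCoord q.1 ^ α * lastCoord q.2 ^ β) := by
      fun_prop
    exact this

theorem hardyIntegral_eq {m : ℕ} {s p α β γ : ℝ} (hγ : γ * p = 1 + α + β - s * p)
    {u : EuclideanSpace ℝ (Fin (m + 1)) → ℝ} (hu : Measurable u) :
    hardyIntegral (m + 1) s p α β u =
      ∫⁻ x, ENNReal.ofReal (|lastCoord x ^ γ * u x| ^ p) ∂halfMeasure m := by
  rw [hardyIntegral, lintegral_halfMeasure (by fun_prop)]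
  refine setLIntegral_congr_fun (measurableSet_halfSpace _) fun x hx => ?_
  have hX : 0 < lastCoord x := hx
  rw [← ENNReal.ofReal_mul (by positivity), abs_mul, abs_of_pos (Real.rpow_pos_of_pos hX γ),
    Real.mul_rpow (by positivity) (by positivity), ← Real.rpow_mul hX.le, hγ,
    show 1 + α + β - s * p = 1 - (s * p - α - β) by ring, Real.rpow_sub hX 1, Real.rpow_one]
  congr 1
  field_simp

/-- The support is compact inside the open half-space, so the integrand is bounded on it. -/
theorem hardyIntegral_ne_top {d : ℕ} [NeZero d] {s p α β : ℝ} (hp : 0 < p)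
    {u : EuclideanSpace ℝ (Fin d) → ℝ} (hu : u ∈ Cc (halfSpace d)) :
    hardyIntegral d s p α β u ≠ ∞ := by
  obtain ⟨hc, hcs, hsub⟩ := hu
  have hcont : ContinuousOn (fun x => |u x| ^ p / lastCoord x ^ (s * p - α - β)) (tsupport u) := by
    apply ContinuousOn.div
    · exact (hc.abs.rpow_const fun x => Or.inr hp.le).continuousOn
    · exact continuous_lastCoord.continuousOn.rpow_const fun x hx => Or.inl (hsub hx).ne'
    · exact fun x hx => (Real.rpow_pos_of_pos (hsub hx) _).ne'
  obtain ⟨M, hM⟩ := hcs.isCompact.exists_bound_of_continuousOn hcont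
  have hle : hardyIntegral d s p α β u ≤ ∫⁻ x in tsupport u, ENNReal.ofReal M := by
    rw [hardyIntegral, ← lintegral_indicator (isClosed_tsupport u).measurableSet]
    refine (setLIntegral_le_lintegral _ _).trans (lintegral_mono fun x => ?_)
    by_cases hx : x ∈ tsupport u
    · rw [indicator_of_mem hx]
      exact ENNReal.ofReal_le_ofReal ((le_abs_self _).trans (hM x hx))
    · simp [image_eq_zero_of_notMem_tsupport hx, Real.zero_rpow hp.ne']
  refine (hle.trans_lt ?_).ne
  rw [setLIntegral_const]
  exact ENNReal.mul_lt_top ENNReal.ofReal_lt_top hcs.isCompact.measure_lt_top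

/-- The constant as an extended real integral over the slab. -/
theorem setLIntegral_slab_hardyConstIntegrand {m : ℕ} {s p α β γ : ℝ} (hsp : -1 < s * p)
    (hp : 0 < p) (hγ : γ * p = 1 + α + β - s * p)
    (hint : IntervalIntegrable (hardyConstIntegrand s p α β) volume 0 1) :
    ∫⁻ η in slab m, ENNReal.ofReal (‖η‖ ^ (-(((m + 1 : ℕ) : ℝ) + s * p))) *
        ENNReal.ofReal ((1 - lastCoord η) ^ α + (1 - lastCoord η) ^ β) *
        ENNReal.ofReal (|1 - (1 - lastCoord η) ^ (-γ)| ^ p) =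
      ENNReal.ofReal (hardyConst (m + 1) s p α β) := by
  have hγ' : (1 + α + β - s * p) / p = γ := by rw [← hγ]; field_simp
  simp only [mul_assoc]
  rw [setLIntegral_slab (G := fun r => ENNReal.ofReal ((1 - r) ^ α + (1 - r) ^ β) *
        ENNReal.ofReal (|1 - (1 - r) ^ (-γ)| ^ p)) hsp (by fun_prop), hardyConst, ← sliceConst,
    ENNReal.ofReal_mul (sliceConst_pos m hsp).le]
  congr 1
  -- The slab is sliced by `r = η_d`, the constant is written in `t = 1 - r`.
  have hsym := hint.comp_sub_left 1
  simp only [sub_self, sub_zero] at hsym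
  have hnn : ∀ r ∈ Ioo (0 : ℝ) 1, 0 ≤ hardyConstIntegrand s p α β (1 - r) := by
    intro r hr
    have h1 : 0 < 1 - r := by linarith [hr.2]
    have h2 : 0 < r := hr.1
    unfold hardyConstIntegrand
    rw [sub_sub_cancel]
    positivity
  have hI : ∫ t in (0 : ℝ)..1, hardyConstIntegrand s p α β t =
      ∫ r in Ioo (0 : ℝ) 1, hardyConstIntegrand s p α β (1 - r) := by
    rw [← integral_Ioc_eq_integral_Ioo, ← intervalIntegral.integral_of_le zero_le_one,
      intervalIntegral.integral_comp_sub_left (fun r => hardyConstIntegrand s p α β r)]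
    simp
  rw [hI, ofReal_integral_eq_lintegral_ofReal]
  · refine setLIntegral_congr_fun measurableSet_Ioo fun r hr => ?_
    have h1 : 0 < 1 - r := by linarith [hr.2]
    have h2 : 0 < r := hr.1
    rw [← ENNReal.ofReal_mul (by positivity), ← ENNReal.ofReal_mul (by positivity),
      hardyConstIntegrand, sub_sub_cancel, hγ', Real.rpow_neg h2.le]
    congr 1
    field_simp
  · exact (intervalIntegrable_iff_integrableOn_Ioo_of_le zero_le_one).1 hsym.symm
  · filter_upwards [ae_restrict_mem measurableSet_Ioo] with r hr using hnn r hr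

/-- The weighted fractional Hardy inequality. -/
theorem hardyConst_mul_hardyIntegral_le {m : ℕ} {s p α β : ℝ} (hsp : -1 < s * p) (hp : 1 ≤ p)
    (hint : IntervalIntegrable (hardyConstIntegrand s p α β) volume 0 1)
    {u : EuclideanSpace ℝ (Fin (m + 1)) → ℝ} (hu : u ∈ Cc (halfSpace (m + 1))) :
    ENNReal.ofReal (hardyConst (m + 1) s p α β) * hardyIntegral (m + 1) s p α β u ≤
      weightedEnergy (m + 1) s p α β u := by
  have hp0 : 0 < p := by linarith
  set γ := (1 + α + β - s * p) / p with hγ_def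
  have hγ : γ * p = 1 + α + β - s * p := by rw [hγ_def]; field_simp
  have hum : Measurable u := hu.1.measurable
  have hfin := hardyIntegral_ne_top (s := s) (α := α) (β := β) hp0 hu
  rw [← setLIntegral_slab_hardyConstIntegrand hsp hp0 hγ hint, weightedEnergy_eq hγ hum,
    ← lintegral_mul_const' _ _ hfin]
  refine setLIntegral_mono' (measurableSet_slab m) fun η hη => ?_
  rw [mul_assoc]
  refine mul_le_mul_right ?_ _
  rw [hardyIntegral_eq hγ hum] at hfin ⊢
  have ht : 0 < 1 - lastCoord η := by linarith [hη.2]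
  exact abs_one_sub_rpow_mul_lintegral_le (measurePreserving_shear hη) hp
    (Real.rpow_nonneg ht.le _) (v := fun x => lastCoord x ^ γ * u x) (by fun_prop) hfin

/-! ### Convergence and positivity of the constant. -/

theorem one_sub_rpow_le {t κ : ℝ} (h0 : 0 < t) (h1 : t < 1) :
    1 - t ^ κ ≤ max 1 κ * (1 - t) := by
  rcases le_total κ 1 with h | h
  · have := Real.rpow_le_rpow_of_exponent_ge h0 h1.le h
    rw [Real.rpow_one] at this
    rw [max_eq_left h]; linarith
  · have := one_add_mul_self_le_rpow_one_add (s := t - 1) (by linarith) h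
    rw [add_sub_cancel] at this
    rw [max_eq_right h]; linarith

theorem abs_one_sub_rpow_neg_le {t γ : ℝ} (h0 : 0 < t) (h1 : t < 1) :
    |1 - t ^ (-γ)| ≤ max 1 |γ| * (t ^ (-max γ 0) * (1 - t)) := by
  rcases le_total γ 0 with h | h
  · rw [max_eq_right h, neg_zero, Real.rpow_zero, one_mul, abs_of_nonpos h, abs_of_nonneg]
    · exact one_sub_rpow_le h0 h1
    · have := Real.rpow_le_one h0.le h1.le (neg_nonneg.2 h)
      linarith
  · have hpos := Real.rpow_pos_of_pos h0 γ
    have hle := Real.rpow_le_one h0.le h1.le h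
    rw [max_eq_left h, Real.rpow_neg h0.le, abs_of_nonneg h,
      show 1 - (t ^ γ)⁻¹ = -((t ^ γ)⁻¹ * (1 - t ^ γ)) by field_simp; ring, abs_neg,
      abs_of_nonneg (mul_nonneg (inv_nonneg.2 hpos.le) (by linarith)), mul_left_comm]
    exact mul_le_mul_of_nonneg_left (one_sub_rpow_le h0 h1) (inv_nonneg.2 hpos.le)

/-- Near `t = 1` the factor `|1 - t^(-γ)|^p` is `O((1-t)^p)`, leaving the exponent `p - 1 - sp > -1`
because `s < 1`. Near `t = 0` it costs at most `t^(-c)` with `c = max (γp) 0`; then `α - c` is `α`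
or `sp - 1 - β`, and symmetrically for `β`, so the upper bounds on `α` and `β` suffice. A sum of two
beta integrands dominates. -/
theorem intervalIntegrable_hardyConstIntegrand {s p α β : ℝ} (hs1 : s < 1) (hp : 1 ≤ p)
    (hα : α ∈ Ioo (-1) (s * p)) (hβ : β ∈ Ioo (-1) (s * p)) :
    IntervalIntegrable (hardyConstIntegrand s p α β) volume 0 1 := by
  have hp0 : 0 < p := by linarith
  set γ := (1 + α + β - s * p) / p with hγ_def
  have hγ : γ * p = 1 + α + β - s * p := by rw [hγ_def]; field_simp
  set M := (max 1 |γ|) ^ p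
  set c := max γ 0 * p with hc_def
  have hc : c = max (1 + α + β - s * p) 0 := by
    rw [hc_def, max_mul_of_nonneg _ _ hp0.le, hγ, zero_mul]
  have hαc : -1 < α - c := by
    rw [hc]; have := hα.1; have := hβ.2
    rcases max_cases (1 + α + β - s * p) 0 with h | h <;> linarith
  have hβc : -1 < β - c := by
    rw [hc]; have := hβ.1; have := hα.2
    rcases max_cases (1 + α + β - s * p) 0 with h | h <;> linarith
  have hb : -1 < p - (1 + s * p) := by nlinarith
  have hdom := ((intervalIntegrable_rpow_mul_one_sub_rpow hαc hb).add
    (intervalIntegrable_rpow_mul_one_sub_rpow hβc hb)).const_mul M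
  rw [intervalIntegrable_iff_integrableOn_Ioo_of_le zero_le_one] at hdom ⊢
  refine hdom.mono' ?_ ?_
  · apply Measurable.aestronglyMeasurable
    unfold hardyConstIntegrand
    fun_prop
  · filter_upwards [ae_restrict_mem measurableSet_Ioo] with t ht
    have h0 := ht.1
    have h1 : 0 < 1 - t := by linarith [ht.2]
    have hM : (max 1 |γ| * (t ^ (-max γ 0) * (1 - t))) ^ p =
        M * ((t ^ c)⁻¹ * (1 - t) ^ p) := by
      rw [Real.mul_rpow (by positivity) (by positivity),
        Real.mul_rpow (by positivity) (by positivity), ← Real.rpow_mul h0.le, neg_mul,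
        Real.rpow_neg h0.le]
    have hle := Real.rpow_le_rpow (abs_nonneg _) (abs_one_sub_rpow_neg_le (γ := γ) h0 ht.2) hp0.le
    rw [hM] at hle
    rw [hardyConstIntegrand, ← hγ_def, Real.norm_of_nonneg (by positivity)]
    calc _ ≤ (t ^ α + t ^ β) * (M * ((t ^ c)⁻¹ * (1 - t) ^ p)) / (1 - t) ^ (1 + s * p) := by
          gcongr
      _ = _ := by
          rw [Real.rpow_sub h0, Real.rpow_sub h0, Real.rpow_sub h1]
          field_simp

theorem hardyConst_pos {m : ℕ} {s p α β : ℝ} (hp : 0 < p) (hsp : -1 < s * p)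
    (hne : 1 + α + β ≠ s * p)
    (hint : IntervalIntegrable (hardyConstIntegrand s p α β) volume 0 1) :
    0 < hardyConst (m + 1) s p α β := by
  refine mul_pos (sliceConst_pos m hsp) ?_
  refine intervalIntegral.intervalIntegral_pos_of_pos_on hint (fun t ht => ?_) zero_lt_one
  have h0 := ht.1
  have h1 : 0 < 1 - t := by linarith [ht.2]
  have hγ : -((1 + α + β - s * p) / p) ≠ 0 :=
    neg_ne_zero.2 (div_ne_zero (sub_ne_zero.2 hne) hp.ne')
  have : 1 - t ^ (-((1 + α + β - s * p) / p)) ≠ 0 := by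
    intro h
    have h2 : t ^ (-((1 + α + β - s * p) / p)) = 1 := by linarith
    exact hγ ((Real.rpow_right_inj h0 ht.2.ne).1 (h2.trans (Real.rpow_zero t).symm))
  unfold hardyConstIntegrand
  positivity

/-! ### Upper bounds for almost invariant functions. -/

/-- A consequence of the convexity of `|·|^p`. -/
theorem abs_add_rpow_le {p θ : ℝ} (hp : 1 ≤ p) (h0 : 0 < θ) (h1 : θ < 1) (a b : ℝ) :
    |a + b| ^ p ≤ (1 - θ) ^ (1 - p) * |a| ^ p + θ ^ (1 - p) * |b| ^ p := by
  have h1' : 0 < 1 - θ := by linarith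
  have hp0 : 0 ≤ p := by linarith
  -- Convexity for `|a| + |b| = (1-θ) (|a|/(1-θ)) + θ (|b|/θ)`; as `θ → 0` the coefficient of
  -- `|a|^p` tends to `1`.
  have hconv := (convexOn_rpow hp).2 (x := |a| / (1 - θ)) (y := |b| / θ)
    (mem_Ici.2 (by positivity)) (mem_Ici.2 (by positivity)) h1'.le h0.le (by ring)
  simp only [smul_eq_mul] at hconv
  rw [mul_div_cancel₀ _ h1'.ne', mul_div_cancel₀ _ h0.ne', Real.div_rpow (abs_nonneg _) h1'.le,
    Real.div_rpow (abs_nonneg _) h0.le] at hconv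
  refine (Real.rpow_le_rpow (abs_nonneg _) (abs_add_le a b) hp0).trans (hconv.trans_eq ?_)
  rw [Real.rpow_sub h1', Real.rpow_sub h0, Real.rpow_one, Real.rpow_one]
  field_simp

theorem lintegral_abs_add_rpow_le {X : Type*} [MeasurableSpace X] {μ : Measure X} {p θ : ℝ}
    (hp : 1 ≤ p) (h0 : 0 < θ) (h1 : θ < 1) {f g : X → ℝ} (hf : Measurable f)
    (hg : Measurable g) :
    ∫⁻ x, ENNReal.ofReal (|f x + g x| ^ p) ∂μ ≤
      ENNReal.ofReal ((1 - θ) ^ (1 - p)) * ∫⁻ x, ENNReal.ofReal (|f x| ^ p) ∂μ +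
        ENNReal.ofReal (θ ^ (1 - p)) * ∫⁻ x, ENNReal.ofReal (|g x| ^ p) ∂μ := by
  have h1' : 0 < 1 - θ := by linarith
  rw [← lintegral_const_mul _ (by fun_prop), ← lintegral_const_mul _ (by fun_prop),
    ← lintegral_add_left (by fun_prop)]
  refine lintegral_mono fun x => ?_
  rw [← ENNReal.ofReal_mul (by positivity), ← ENNReal.ofReal_mul (by positivity),
    ← ENNReal.ofReal_add (by positivity) (by positivity)]
  exact ENNReal.ofReal_le_ofReal (abs_add_rpow_le hp h0 h1 _ _)

theorem lintegral_abs_const_mul_rpow {X : Type*} [MeasurableSpace X] {μ : Measure X} {p : ℝ}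
    (c : ℝ) {f : X → ℝ} (hf : Measurable f) :
    ∫⁻ x, ENNReal.ofReal (|c * f x| ^ p) ∂μ =
      ENNReal.ofReal (|c| ^ p) * ∫⁻ x, ENNReal.ofReal (|f x| ^ p) ∂μ := by
  rw [← lintegral_const_mul _ (by fun_prop)]
  refine lintegral_congr fun x => ?_
  rw [← ENNReal.ofReal_mul (by positivity), abs_mul, Real.mul_rpow (abs_nonneg _) (abs_nonneg _)]

/-- Upper bound for the `L^p` norm of `v - τ (v ∘ T)` by that of `v` and of `v - v ∘ T`. -/
theorem lintegral_sub_mul_comp_le {X : Type*} [MeasurableSpace X] {μ : Measure X}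
    {T : X → X} (hT : MeasurePreserving T μ μ) {p τ θ : ℝ} (hp : 1 ≤ p) (hτ : 0 ≤ τ)
    (h0 : 0 < θ) (h1 : θ < 1) {v : X → ℝ} (hv : Measurable v) :
    ∫⁻ x, ENNReal.ofReal (|v x - τ * v (T x)| ^ p) ∂μ ≤
      ENNReal.ofReal ((1 - θ) ^ (1 - p)) *
        (ENNReal.ofReal (|1 - τ| ^ p) * ∫⁻ x, ENNReal.ofReal (|v x| ^ p) ∂μ) +
      ENNReal.ofReal (θ ^ (1 - p)) * ∫⁻ x, ENNReal.ofReal (|v x - v (T x)| ^ p) ∂μ := by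
  have hvT : Measurable fun x => v (T x) := hv.comp hT.measurable
  -- The splitting is `(1-τ) v + τ (v - v ∘ T)` for `τ ≤ 1` and `(1-τ) v ∘ T + (v - v ∘ T)` for `τ ≥
  -- 1`, so that the error term has a coefficient at most `1`, uniformly in `τ`.
  rcases le_total τ 1 with h | h
  · have := lintegral_abs_add_rpow_le (μ := μ) hp h0 h1 (hv.const_mul (1 - τ))
      ((hv.sub hvT).const_mul τ)
    rw [lintegral_abs_const_mul_rpow _ hv, lintegral_abs_const_mul_rpow _ (hv.sub hvT)] at this
    refine le_trans (le_of_eq ?_) (this.trans ?_)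
    · refine lintegral_congr fun x => ?_
      congr 3; simp only [Pi.sub_apply]; ring
    · gcongr
      refine mul_le_of_le_one_left zero_le ?_
      rw [ENNReal.ofReal_le_one, abs_of_nonneg hτ]
      exact Real.rpow_le_one hτ h (by linarith)
  · have := lintegral_abs_add_rpow_le (μ := μ) hp h0 h1 (hvT.const_mul (1 - τ)) (hv.sub hvT)
    rw [lintegral_abs_const_mul_rpow _ hvT, hT.lintegral_comp (f := fun x =>
      ENNReal.ofReal (|v x| ^ p)) (by fun_prop)] at this
    refine le_trans (le_of_eq ?_) this
    refine lintegral_congr fun x => ?_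
    congr 3; simp only [Pi.sub_apply]; ring

/-! ### Tents and slowly varying cut-offs. -/

/-- The function `z ↦ max 0 (1 - ‖z‖)`. -/
noncomputable def tent {F : Type*} [NormedAddCommGroup F] (z : F) : ℝ := max 0 (1 - ‖z‖)

section tent
variable {F : Type*} [NormedAddCommGroup F]

@[fun_prop]
theorem continuous_tent : Continuous (tent : F → ℝ) := by unfold tent; fun_prop

@[fun_prop]
theorem measurable_tent [MeasurableSpace F] [BorelSpace F] : Measurable (tent : F → ℝ) :=
  continuous_tent.measurable

theorem tent_nonneg (z : F) : 0 ≤ tent z := le_max_left _ _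

theorem tent_le_one (z : F) : tent z ≤ 1 := max_le zero_le_one (by linarith [norm_nonneg z])

theorem tent_eq_zero {z : F} (hz : 1 ≤ ‖z‖) : tent z = 0 := max_eq_left (by linarith)

theorem abs_tent_sub_le (z w : F) : |tent z - tent w| ≤ ‖z - w‖ := by
  unfold tent
  refine (abs_max_sub_max_le_max _ _ _ _).trans (max_le (by simp) ?_)
  rw [show 1 - ‖z‖ - (1 - ‖w‖) = ‖w‖ - ‖z‖ by ring, norm_sub_rev]
  exact abs_norm_sub_norm_le _ _

variable [InnerProductSpace ℝ F] [FiniteDimensional ℝ F] [MeasurableSpace F] [BorelSpace F]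

theorem lintegral_tent_ne_top {p : ℝ} (hp : 0 < p) :
    ∫⁻ z : F, ENNReal.ofReal (|tent z| ^ p) ≠ ∞ := by
  have hle : ∫⁻ z : F, ENNReal.ofReal (|tent z| ^ p) ≤
      ∫⁻ z : F in Metric.closedBall 0 1, 1 := by
    rw [← lintegral_indicator measurableSet_closedBall]
    refine lintegral_mono fun z => ?_
    by_cases hz : z ∈ Metric.closedBall (0 : F) 1
    · rw [indicator_of_mem hz, ENNReal.ofReal_le_one, abs_of_nonneg (tent_nonneg z)]
      exact Real.rpow_le_one (tent_nonneg z) (tent_le_one z) hp.le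
    · rw [mem_closedBall_zero_iff, not_le] at hz
      simp [tent_eq_zero hz.le, Real.zero_rpow hp.ne']
  refine (hle.trans_lt ?_).ne
  rw [setLIntegral_one]
  exact measure_closedBall_lt_top

theorem lintegral_tent_ne_zero {p : ℝ} (hp : 0 < p) :
    ∫⁻ z : F, ENNReal.ofReal (|tent z| ^ p) ≠ 0 := by
  have hc : Continuous fun z : F => ENNReal.ofReal (|tent z| ^ p) :=
    ENNReal.continuous_ofReal.comp (continuous_tent.abs.rpow_const fun _ => Or.inr hp.le)
  intro h
  rw [lintegral_eq_zero_iff hc.measurable, hc.ae_eq_iff_eq volume continuous_zero] at h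
  have := congrFun h 0
  simp [tent] at this

/-- The tent is 1-Lipschitz, and the difference vanishes outside the union of two unit balls. -/
theorem lintegral_tent_sub_le {p : ℝ} (hp : 0 < p) (h : F) :
    ∫⁻ z : F, ENNReal.ofReal (|tent z - tent (z - h)| ^ p) ≤
      ENNReal.ofReal (‖h‖ ^ p) * (2 * volume (Metric.closedBall (0 : F) 1)) := by
  let B := (Metric.closedBall (0 : F) 1).indicator (1 : F → ℝ≥0∞)
  have hB : Measurable B := measurable_one.indicator measurableSet_closedBall
  calc _ ≤ ∫⁻ z : F, ENNReal.ofReal (‖h‖ ^ p) * (B z + B (z - h)) := by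
        refine lintegral_mono fun z => ?_
        have h1 : ENNReal.ofReal (|tent z - tent (z - h)| ^ p) ≤ ENNReal.ofReal (‖h‖ ^ p) := by
          refine ENNReal.ofReal_le_ofReal (Real.rpow_le_rpow (abs_nonneg _) ?_ hp.le)
          simpa using abs_tent_sub_le z (z - h)
        by_cases hz : z ∈ Metric.closedBall (0 : F) 1
        · refine h1.trans (le_mul_of_one_le_right zero_le ?_)
          have : B z = 1 := indicator_of_mem hz _
          rw [this]; exact le_self_add
        · by_cases hz' : z - h ∈ Metric.closedBall (0 : F) 1
          · refine h1.trans (le_mul_of_one_le_right zero_le ?_)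
            have : B (z - h) = 1 := indicator_of_mem hz' _
            rw [this]; exact le_add_self
          · rw [mem_closedBall_zero_iff, not_le] at hz hz'
            simp [tent_eq_zero hz.le, tent_eq_zero hz'.le, Real.zero_rpow hp.ne']
    _ = _ := by
        rw [lintegral_const_mul _ (by fun_prop), lintegral_add_left hB,
          lintegral_sub_right_eq_self B h, lintegral_indicator_one measurableSet_closedBall, two_mul]

end tent

theorem lintegral_Ioi_inv_mul_comp_log (g : ℝ → ℝ≥0∞) :
    ∫⁻ r in Ioi (0 : ℝ), ENNReal.ofReal r⁻¹ * g (Real.log r) = ∫⁻ l, g l := by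
  have h := lintegral_image_eq_lintegral_abs_deriv_mul (s := univ) (f := Real.exp)
    (f' := Real.exp) MeasurableSet.univ (fun x _ => (Real.hasDerivAt_exp x).hasDerivWithinAt)
    Real.exp_injective.injOn (fun r => ENNReal.ofReal r⁻¹ * g (Real.log r))
  rw [image_univ, Real.range_exp, Measure.restrict_univ] at h
  rw [h]
  refine lintegral_congr fun l => ?_
  have := Real.exp_pos l
  rw [← mul_assoc, ← ENNReal.ofReal_mul (abs_nonneg _), abs_of_pos this,
    mul_inv_cancel₀ this.ne', Real.log_exp]
  simp

/-- In the coordinates `(log x_d, x')` the invariant measure is Lebesgue measure. -/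
theorem lintegral_halfMeasure_log {m : ℕ} {f : ℝ → EuclideanSpace ℝ (Fin m) → ℝ≥0∞}
    (hf : Measurable (Function.uncurry f)) :
    ∫⁻ x, f (Real.log (lastCoord x)) (initCoord x) ∂halfMeasure m = ∫⁻ l, ∫⁻ z, f l z := by
  have hf' : Measurable fun q : ℝ × EuclideanSpace ℝ (Fin m) => f (Real.log q.1) q.2 :=
    hf.comp ((Real.measurable_log.comp measurable_fst).prodMk measurable_snd)
  rw [lintegral_halfMeasure (f := fun x => f (Real.log (lastCoord x)) (initCoord x))
    (hf'.comp (measurable_lastCoord.prodMk measurable_initCoord))]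
  have h := setLIntegral_lastCoord_preimage (m := m)
    (f := fun r z => ENNReal.ofReal r⁻¹ * f (Real.log r) z)
    (Measurable.mul (by fun_prop) hf') (A := Ioi 0) measurableSet_Ioi
  refine Eq.trans h ?_
  rw [← lintegral_Ioi_inv_mul_comp_log]
  refine lintegral_congr fun r => ?_
  rw [lintegral_const_mul' _ _ ENNReal.ofReal_ne_top]

theorem lintegral_comp_inv_smul {F : Type*} [NormedAddCommGroup F] [InnerProductSpace ℝ F]
    [FiniteDimensional ℝ F] [MeasurableSpace F] [BorelSpace F] {R : ℝ} (hR : 0 < R)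
    (g : F → ℝ≥0∞) :
    ∫⁻ z : F, g (R⁻¹ • z) = ENNReal.ofReal (R ^ Module.finrank ℝ F) * ∫⁻ z, g z := by
  rw [lintegral_comp_smul_addHaar volume hR]
  simp [smul_smul, ne_of_gt hR]

/-- A slowly varying cut-off function in the half-space, a product of tents in the variables
`log x_d` and `x'`. -/
noncomputable def cutoff {m : ℕ} (n R : ℝ) (x : EuclideanSpace ℝ (Fin (m + 1))) : ℝ :=
  tent (n⁻¹ • Real.log (lastCoord x)) * tent (R⁻¹ • initCoord x)

@[fun_prop]
theorem measurable_cutoff {m : ℕ} (n R : ℝ) :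
    Measurable (cutoff n R : EuclideanSpace ℝ (Fin (m + 1)) → ℝ) := by
  unfold cutoff; fun_prop

/-- The integral `∫ |tent|^p`. -/
noncomputable def tentMass (F : Type*) [NormedAddCommGroup F] [InnerProductSpace ℝ F]
    [FiniteDimensional ℝ F] [MeasurableSpace F] [BorelSpace F] (p : ℝ) : ℝ≥0∞ :=
  ∫⁻ z : F, ENNReal.ofReal (|tent z| ^ p)

theorem lintegral_cutoff {m : ℕ} {p n R : ℝ} (hn : 0 < n) (hR : 0 < R) :
    ∫⁻ x, ENNReal.ofReal (|cutoff n R x| ^ p) ∂halfMeasure m =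
      ENNReal.ofReal (n * R ^ m) * (tentMass ℝ p * tentMass (EuclideanSpace ℝ (Fin m)) p) := by
  unfold cutoff
  rw [lintegral_halfMeasure_log (f := fun l z =>
    ENNReal.ofReal (|tent (n⁻¹ • l) * tent (R⁻¹ • z)| ^ p)) (by
      unfold Function.uncurry; fun_prop)]
  have h1 : ∀ l : ℝ, ∫⁻ z : EuclideanSpace ℝ (Fin m),
      ENNReal.ofReal (|tent (n⁻¹ • l) * tent (R⁻¹ • z)| ^ p) =
      ENNReal.ofReal (|tent (n⁻¹ • l)| ^ p) *
        (ENNReal.ofReal (R ^ m) * tentMass (EuclideanSpace ℝ (Fin m)) p) := by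
    intro l
    rw [lintegral_abs_const_mul_rpow _ (by fun_prop),
      lintegral_comp_inv_smul hR (fun z : EuclideanSpace ℝ (Fin m) =>
        ENNReal.ofReal (|tent z| ^ p)), finrank_euclideanSpace_fin]
    rfl
  simp only [h1]
  rw [lintegral_mul_const _ (by fun_prop), lintegral_comp_inv_smul hn (fun l : ℝ =>
        ENNReal.ofReal (|tent l| ^ p)), Module.finrank_self, pow_one, ENNReal.ofReal_mul hn.le]
  change ENNReal.ofReal n * tentMass ℝ p * _ = _
  ring

/-- In the coordinates `l = log x_d`, `z = x'`, the shear is `(l, z) ↦ (l + log (1 - η_d), z - e^l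
η')`: a translation in `l`, and in `z` a translation whose length depends on `l`. -/
theorem cutoff_shear {m : ℕ} {n R : ℝ} {η x : EuclideanSpace ℝ (Fin (m + 1))} (hη : η ∈ slab m)
    (hx : 0 < lastCoord x) :
    cutoff n R (shear η x) =
      tent (n⁻¹ • (Real.log (lastCoord x) + Real.log (1 - lastCoord η))) *
        tent (R⁻¹ • (initCoord x - Real.exp (Real.log (lastCoord x)) • initCoord η)) := by
  have ht : 0 < 1 - lastCoord η := by linarith [hη.2]
  rw [cutoff, lastCoord_shear, initCoord_shear, Real.log_mul ht.ne' hx.ne', Real.exp_log hx,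
    add_comm]

theorem ae_halfMeasure (m : ℕ) : ∀ᵐ x ∂halfMeasure m, 0 < lastCoord x :=
  (withDensity_absolutelyContinuous _ _).ae_le (ae_restrict_mem (measurableSet_halfSpace _))

/-- The first tent vanishes for `l > n`, so the displacement `e^l ζ` has length at most `e^n ‖ζ‖`
where it matters. With `R = n e^n` the relative displacement becomes `‖ζ‖ / n`. -/
theorem lintegral_tent_mul_tent_sub_le {m : ℕ} {p n R : ℝ} (hp : 0 < p) (hn : 0 < n) (hR : 0 < R)
    (ζ : EuclideanSpace ℝ (Fin m)) :
    ∫⁻ l : ℝ, ∫⁻ z : EuclideanSpace ℝ (Fin m), ENNReal.ofReal (|tent (n⁻¹ • l) *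
        (tent (R⁻¹ • z) - tent (R⁻¹ • (z - Real.exp l • ζ)))| ^ p) ≤
      ENNReal.ofReal (n * R ^ m) * (tentMass ℝ p *
        (ENNReal.ofReal ((Real.exp n * ‖ζ‖ / R) ^ p) *
          (2 * volume (Metric.closedBall (0 : EuclideanSpace ℝ (Fin m)) 1)))) := by
  calc _ ≤ ∫⁻ l : ℝ, ENNReal.ofReal (|tent (n⁻¹ • l)| ^ p) * (ENNReal.ofReal (R ^ m) *
        (ENNReal.ofReal ((Real.exp n * ‖ζ‖ / R) ^ p) *
        (2 * volume (Metric.closedBall (0 : EuclideanSpace ℝ (Fin m)) 1)))) := by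
        refine lintegral_mono fun l => ?_
        rw [lintegral_abs_const_mul_rpow _ (by fun_prop)]
        by_cases hl : l ≤ n
        · gcongr
          simp only [smul_sub]
          rw [lintegral_comp_inv_smul hR (fun w : EuclideanSpace ℝ (Fin m) => ENNReal.ofReal
            (|tent w - tent (w - R⁻¹ • Real.exp l • ζ)| ^ p)), finrank_euclideanSpace_fin]
          gcongr
          refine (lintegral_tent_sub_le hp _).trans ?_
          gcongr
          rw [norm_smul, norm_smul, Real.norm_of_nonneg (inv_pos.2 hR).le,
            Real.norm_of_nonneg (Real.exp_pos l).le, div_eq_inv_mul]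
          gcongr
        · have : tent (n⁻¹ • l) = 0 := by
            apply tent_eq_zero
            rw [not_le] at hl
            rw [smul_eq_mul, ← div_eq_inv_mul, Real.norm_of_nonneg (by
              apply div_nonneg _ hn.le; linarith), one_le_div hn]
            exact hl.le
          rw [this]
          simp [Real.zero_rpow hp.ne']
    _ = _ := by
        rw [lintegral_mul_const _ (by fun_prop),
          lintegral_comp_inv_smul hn (fun l : ℝ => ENNReal.ofReal (|tent l| ^ p)),
          Module.finrank_self, pow_one, ENNReal.ofReal_mul hn.le]
        change ENNReal.ofReal n * tentMass ℝ p * _ = _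
        ring

theorem lintegral_tent_sub_mul_tent_le {m : ℕ} {p n R : ℝ} (hp : 0 < p) (hn : 0 < n) (hR : 0 < R)
    (L : ℝ) (ζ : EuclideanSpace ℝ (Fin m)) :
    ∫⁻ l : ℝ, ∫⁻ z : EuclideanSpace ℝ (Fin m), ENNReal.ofReal
        (|(tent (n⁻¹ • l) - tent (n⁻¹ • (l + L))) * tent (R⁻¹ • (z - Real.exp l • ζ))| ^ p) ≤
      ENNReal.ofReal (n * R ^ m) * (tentMass (EuclideanSpace ℝ (Fin m)) p *
        (ENNReal.ofReal ((|L| / n) ^ p) * (2 * volume (Metric.closedBall (0 : ℝ) 1)))) := by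
  have h1 : ∀ l : ℝ, ∫⁻ z : EuclideanSpace ℝ (Fin m), ENNReal.ofReal
        (|(tent (n⁻¹ • l) - tent (n⁻¹ • (l + L))) * tent (R⁻¹ • (z - Real.exp l • ζ))| ^ p) =
      ENNReal.ofReal (|tent (n⁻¹ • l) - tent (n⁻¹ • l - n⁻¹ • (-L))| ^ p) *
        (ENNReal.ofReal (R ^ m) * tentMass (EuclideanSpace ℝ (Fin m)) p) := by
    intro l
    rw [lintegral_abs_const_mul_rpow _ (by fun_prop),
      lintegral_sub_right_eq_self (fun z : EuclideanSpace ℝ (Fin m) =>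
        ENNReal.ofReal (|tent (R⁻¹ • z)| ^ p)),
      lintegral_comp_inv_smul hR (fun z : EuclideanSpace ℝ (Fin m) =>
        ENNReal.ofReal (|tent z| ^ p)),
      finrank_euclideanSpace_fin, smul_neg, sub_neg_eq_add, smul_add]
    rfl
  simp only [h1]
  rw [lintegral_mul_const _ (by fun_prop), lintegral_comp_inv_smul hn (fun w : ℝ => ENNReal.ofReal
      (|tent w - tent (w - n⁻¹ • (-L))| ^ p)), Module.finrank_self, pow_one,
    ENNReal.ofReal_mul hn.le]
  calc _ ≤ ENNReal.ofReal n * (ENNReal.ofReal (‖n⁻¹ • (-L)‖ ^ p) *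
        (2 * volume (Metric.closedBall (0 : ℝ) 1))) *
        (ENNReal.ofReal (R ^ m) * tentMass (EuclideanSpace ℝ (Fin m)) p) := by
        gcongr
        exact lintegral_tent_sub_le hp _
    _ = _ := by
        rw [norm_smul, norm_neg, Real.norm_of_nonneg (inv_pos.2 hn).le, Real.norm_eq_abs,
          ← div_eq_inv_mul]
        ring

/-- A discrete product rule splits the difference into the change of the `x'` tent and the change of
the `log x_d` tent. -/
theorem lintegral_cutoff_sub_shear_le {m : ℕ} {p n R : ℝ} (hp : 1 ≤ p) (hn : 0 < n) (hR : 0 < R)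
    {η : EuclideanSpace ℝ (Fin (m + 1))} (hη : η ∈ slab m) :
    ∫⁻ x, ENNReal.ofReal (|cutoff n R x - cutoff n R (shear η x)| ^ p) ∂halfMeasure m ≤
      ENNReal.ofReal ((1 / 2) ^ (1 - p)) * (ENNReal.ofReal (n * R ^ m) *
        (tentMass ℝ p * (ENNReal.ofReal ((Real.exp n * ‖initCoord η‖ / R) ^ p) *
          (2 * volume (Metric.closedBall (0 : EuclideanSpace ℝ (Fin m)) 1))) +
        tentMass (EuclideanSpace ℝ (Fin m)) p *
          (ENNReal.ofReal ((|Real.log (1 - lastCoord η)| / n) ^ p) *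
          (2 * volume (Metric.closedBall (0 : ℝ) 1))))) := by
  have hp0 : 0 < p := by linarith
  set L := Real.log (1 - lastCoord η)
  set ζ := initCoord η
  let f : ℝ → EuclideanSpace ℝ (Fin m) → ℝ := fun l z =>
    tent (n⁻¹ • l) * (tent (R⁻¹ • z) - tent (R⁻¹ • (z - Real.exp l • ζ)))
  let g : ℝ → EuclideanSpace ℝ (Fin m) → ℝ := fun l z =>
    (tent (n⁻¹ • l) - tent (n⁻¹ • (l + L))) * tent (R⁻¹ • (z - Real.exp l • ζ))
  have hf : Measurable (Function.uncurry f) := by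
    simp only [f, Function.uncurry_def]; fun_prop
  have hg : Measurable (Function.uncurry g) := by
    simp only [g, Function.uncurry_def]; fun_prop
  have hco : Measurable fun x : EuclideanSpace ℝ (Fin (m + 1)) =>
      (Real.log (lastCoord x), initCoord x) := by fun_prop
  have hsum := lintegral_abs_add_rpow_le (μ := halfMeasure m) hp one_half_pos one_half_lt_one
    (hf.comp hco) (hg.comp hco)
  have ef := lintegral_halfMeasure_log (f := fun l z => ENNReal.ofReal (|f l z| ^ p))
    (ENNReal.measurable_ofReal.comp (hf.abs.pow_const p))
  have eg := lintegral_halfMeasure_log (f := fun l z => ENNReal.ofReal (|g l z| ^ p))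
    (ENNReal.measurable_ofReal.comp (hg.abs.pow_const p))
  simp only [Function.comp_apply, Function.uncurry_apply_pair] at hsum
  rw [ef, eg, show (1 : ℝ) - 1 / 2 = 1 / 2 by norm_num, ← mul_add] at hsum
  have hlhs : ∫⁻ x, ENNReal.ofReal (|cutoff n R x - cutoff n R (shear η x)| ^ p) ∂halfMeasure m =
      ∫⁻ x, ENNReal.ofReal (|f (Real.log (lastCoord x)) (initCoord x) +
          g (Real.log (lastCoord x)) (initCoord x)| ^ p) ∂halfMeasure m := by
    refine lintegral_congr_ae ?_
    filter_upwards [ae_halfMeasure m] with x hx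
    rw [cutoff_shear hη hx, cutoff]
    congr 3
    simp only [f, g]
    ring
  rw [hlhs]
  refine hsum.trans (mul_le_mul_right ?_ _)
  rw [mul_add]
  exact add_le_add (lintegral_tent_mul_tent_sub_le hp0 hn hR ζ)
    (lintegral_tent_sub_mul_tent_le hp0 hn hR L ζ)

/-- Apply `log y ≤ y - 1` to `y = t^(-ε)`, and use `t ≤ t^ε`. -/
theorem abs_log_le_rpow_neg_mul {t ε : ℝ} (h0 : 0 < t) (h1 : t < 1) (hε : 0 < ε) (hε1 : ε ≤ 1) :
    |Real.log t| ≤ t ^ (-ε) * (1 - t) / ε := by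
  rw [abs_of_neg (Real.log_neg h0 h1), le_div_iff₀ hε]
  have hpos := Real.rpow_pos_of_pos h0 (-ε)
  have h2 := Real.log_le_sub_one_of_pos hpos
  rw [Real.log_rpow h0] at h2
  have h3 := Real.rpow_le_rpow_of_exponent_ge h0 h1.le hε1
  rw [Real.rpow_one] at h3
  have h4 : t ^ (-ε) * t ^ ε = 1 := by
    rw [← Real.rpow_add h0]; simp
  nlinarith

theorem norm_initCoord_le {m : ℕ} (η : EuclideanSpace ℝ (Fin (m + 1))) :
    ‖initCoord η‖ ≤ ‖η‖ := by
  refine le_of_sq_le_sq ?_ (norm_nonneg _)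
  rw [norm_sq_eq_lastCoord_add_initCoord]
  nlinarith [sq_nonneg (lastCoord η)]

theorem lastCoord_le_norm {m : ℕ} (η : EuclideanSpace ℝ (Fin (m + 1))) :
    lastCoord η ≤ ‖η‖ := by
  refine le_of_sq_le_sq ?_ (norm_nonneg _)
  rw [norm_sq_eq_lastCoord_add_initCoord]
  nlinarith [sq_nonneg ‖initCoord η‖]

theorem norm_pos_of_mem_slab {m : ℕ} {η : EuclideanSpace ℝ (Fin (m + 1))} (hη : η ∈ slab m) :
    0 < ‖η‖ := lt_of_lt_of_le hη.1 (lastCoord_le_norm η)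

/-- The cut-off functions are asymptotically invariant under shears. -/
theorem exists_lintegral_cutoff_sub_shear_le {m : ℕ} {p q ε : ℝ} (hp : 1 ≤ p) (hq0 : 0 ≤ q)
    (hqp : q ≤ p) (hε : 0 < ε) (hε1 : ε ≤ 1) :
    ∃ C : ℝ≥0∞, C ≠ ∞ ∧ ∀ n : ℝ, 0 < n → ∀ η ∈ slab m,
      ∫⁻ x, ENNReal.ofReal (|cutoff n (n * Real.exp n) x -
          cutoff n (n * Real.exp n) (shear η x)| ^ p) ∂halfMeasure m ≤
        C * (∫⁻ x, ENNReal.ofReal (|cutoff n (n * Real.exp n) x| ^ p) ∂halfMeasure m) *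
          ENNReal.ofReal (((1 - lastCoord η) ^ (-ε) * ‖η‖ / n) ^ q) := by
  have hp0 : 0 < p := by linarith
  set A := tentMass ℝ p
  set B := tentMass (EuclideanSpace ℝ (Fin m)) p
  have hA0 : A ≠ 0 := lintegral_tent_ne_zero hp0
  have hA1 : A ≠ ∞ := lintegral_tent_ne_top hp0
  have hB0 : B ≠ 0 := lintegral_tent_ne_zero hp0
  have hB1 : B ≠ ∞ := lintegral_tent_ne_top hp0
  set V := 2 * volume (Metric.closedBall (0 : EuclideanSpace ℝ (Fin m)) 1) with hV_def
  set W := 2 * volume (Metric.closedBall (0 : ℝ) 1) with hW_def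
  have hV : V ≠ ∞ := ENNReal.mul_ne_top (by simp) measure_closedBall_lt_top.ne
  have hW : W ≠ ∞ := ENNReal.mul_ne_top (by simp) measure_closedBall_lt_top.ne
  set h := ENNReal.ofReal ((1 / 2) ^ (1 - p)) with hh
  have hAB0 : A * B ≠ 0 := mul_ne_zero hA0 hB0
  have hAB1 : A * B ≠ ∞ := ENNReal.mul_ne_top hA1 hB1
  set Q := (A * V + B * W) / (A * B) with hQ_def
  have hQ : Q * (A * B) = A * V + B * W := ENNReal.div_mul_cancel hAB0 hAB1
  have hQ1 : Q ≠ ∞ := ENNReal.div_ne_top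
    (ENNReal.add_ne_top.2 ⟨ENNReal.mul_ne_top hA1 hV, ENNReal.mul_ne_top hB1 hW⟩) hAB0
  set e := ENNReal.ofReal (ε⁻¹ ^ p)
  refine ⟨h * Q * e + (h + h), ?_, ?_⟩
  · refine ENNReal.add_ne_top.2 ⟨ENNReal.mul_ne_top (ENNReal.mul_ne_top ENNReal.ofReal_ne_top hQ1)
      ENNReal.ofReal_ne_top, ENNReal.add_ne_top.2 ⟨ENNReal.ofReal_ne_top, ENNReal.ofReal_ne_top⟩⟩
  intro n hn η hη
  have hR : 0 < n * Real.exp n := mul_pos hn (Real.exp_pos n)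
  set R := n * Real.exp n with hR_def
  have ht : 0 < 1 - lastCoord η := by linarith [hη.2]
  have ht1 : 1 - lastCoord η < 1 := by linarith [hη.1]
  have hηn := norm_pos_of_mem_slab hη
  set t := 1 - lastCoord η with ht_def
  set Y := t ^ (-ε) * ‖η‖ with hY_def
  have htε : 1 ≤ t ^ (-ε) := Real.one_le_rpow_of_pos_of_le_one_of_nonpos ht ht1.le (by linarith)
  have hY : 0 < Y := by positivity
  have hN := lintegral_cutoff (m := m) (p := p) hn hR
  set N := ∫⁻ x, ENNReal.ofReal (|cutoff n R x| ^ p) ∂halfMeasure m with hN_def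
  -- If `Y / n ≤ 1`, both displacements are at most `ε⁻¹ Y / n`, and the exponent `p` may be lowered
  -- to `q`. Otherwise the right-hand side already exceeds the crude bound of the difference by the
  -- sum of the two norms. The summands `h * Q * e` and `h + h` of the constant serve these two
  -- cases.
  by_cases hYn : Y / n ≤ 1
  · have hYe : ENNReal.ofReal ((ε⁻¹ * (Y / n)) ^ p) ≤ e * ENNReal.ofReal ((Y / n) ^ q) := by
      rw [Real.mul_rpow (by positivity) (by positivity), ENNReal.ofReal_mul (by positivity)]
      refine mul_le_mul_right (ENNReal.ofReal_le_ofReal ?_) _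
      exact Real.rpow_le_rpow_of_exponent_ge (by positivity) hYn hqp
    have h1 : ENNReal.ofReal ((Real.exp n * ‖initCoord η‖ / R) ^ p) ≤
        e * ENNReal.ofReal ((Y / n) ^ q) := by
      refine le_trans (ENNReal.ofReal_le_ofReal (Real.rpow_le_rpow (by positivity) ?_ hp0.le)) hYe
      calc Real.exp n * ‖initCoord η‖ / R = ‖initCoord η‖ / n := by rw [hR_def]; field_simp
        _ ≤ 1 * (Y / n) := by
          rw [one_mul]; gcongr
          exact (norm_initCoord_le η).trans (le_mul_of_one_le_left hηn.le htε)
        _ ≤ ε⁻¹ * (Y / n) := by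
          gcongr; exact (one_le_inv₀ hε).2 hε1
    have h2 : ENNReal.ofReal ((|Real.log t| / n) ^ p) ≤ e * ENNReal.ofReal ((Y / n) ^ q) := by
      refine le_trans (ENNReal.ofReal_le_ofReal (Real.rpow_le_rpow (by positivity) ?_ hp0.le)) hYe
      have h3 := abs_log_le_rpow_neg_mul ht ht1 hε hε1
      calc |Real.log t| / n ≤ (t ^ (-ε) * (1 - t) / ε) / n := by gcongr
        _ ≤ (t ^ (-ε) * ‖η‖ / ε) / n := by
          gcongr
          rw [ht_def, sub_sub_cancel]; exact lastCoord_le_norm η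
        _ = ε⁻¹ * (Y / n) := by rw [hY_def]; field_simp
    calc _ ≤ h * (ENNReal.ofReal (n * R ^ m) *
          (A * (ENNReal.ofReal ((Real.exp n * ‖initCoord η‖ / R) ^ p) * V) +
          B * (ENNReal.ofReal ((|Real.log t| / n) ^ p) * W))) :=
          lintegral_cutoff_sub_shear_le hp hn hR hη
      _ ≤ h * (ENNReal.ofReal (n * R ^ m) *
          (A * (e * ENNReal.ofReal ((Y / n) ^ q) * V) +
          B * (e * ENNReal.ofReal ((Y / n) ^ q) * W))) := by gcongr
      _ = (h * Q * e) * N * ENNReal.ofReal ((Y / n) ^ q) := by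
          rw [hN]
          calc _ = h * (ENNReal.ofReal (n * R ^ m) * (A * V + B * W)) * e *
                ENNReal.ofReal ((Y / n) ^ q) := by ring
            _ = _ := by rw [← hQ]; ring
      _ ≤ _ := by gcongr; exact le_self_add
  · rw [not_le] at hYn
    have hT := measurePreserving_shear hη
    have hm : Measurable fun x => cutoff n R (shear η x) := by fun_prop
    have h1 := lintegral_abs_add_rpow_le (μ := halfMeasure m) hp one_half_pos one_half_lt_one
      (measurable_cutoff n R) hm.neg
    have h2 : ∫⁻ x, ENNReal.ofReal (|cutoff n R (shear η x)| ^ p) ∂halfMeasure m = N :=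
      hT.lintegral_comp (f := fun x => ENNReal.ofReal (|cutoff n R x| ^ p)) (by fun_prop)
    simp only [Pi.neg_apply, abs_neg, ← sub_eq_add_neg] at h1
    rw [h2, show (1 : ℝ) - 1 / 2 = 1 / 2 by norm_num, ← add_mul] at h1
    refine h1.trans ?_
    calc (h + h) * N ≤ (h * Q * e + (h + h)) * N * 1 := by
          rw [mul_one]; exact mul_le_mul_left le_add_self N
      _ ≤ _ := by
          gcongr
          rw [ENNReal.one_le_ofReal]
          exact Real.one_le_rpow hYn.le hq0

/-! ### Optimality. -/

/-- The approximate extremals `x_d^(-γ)`, cut off. -/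
noncomputable def extremal {m : ℕ} (γ n R : ℝ) (x : EuclideanSpace ℝ (Fin (m + 1))) : ℝ :=
  if 0 < lastCoord x then lastCoord x ^ (-γ) * cutoff n R x else 0

/-- The tents confine the support to the box `e^(-n) ≤ x_d ≤ e^n`, `‖x'‖ ≤ R`, compact in the
half-space. Off this box the function is locally zero, which gives continuity across `x_d ≤ 0`. -/
theorem extremal_mem_Cc {m : ℕ} (γ : ℝ) {n R : ℝ} (hn : 0 < n) (hR : 0 < R) :
    (extremal γ n R : EuclideanSpace ℝ (Fin (m + 1)) → ℝ) ∈ Cc (halfSpace (m + 1)) := by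
  let K : Set (EuclideanSpace ℝ (Fin (m + 1))) :=
    lastCoord ⁻¹' Icc (Real.exp (-n)) (Real.exp n) ∩ initCoord ⁻¹' Metric.closedBall 0 R
  have hKclosed : IsClosed K := (isClosed_Icc.preimage continuous_lastCoord).inter
    (Metric.isClosed_closedBall.preimage continuous_initCoord)
  have hK : IsCompact K := by
    refine Metric.isCompact_of_isClosed_isBounded hKclosed ?_
    refine isBounded_iff_forall_norm_le.2 ⟨Real.exp n + R, fun x hx => ?_⟩
    have h1 : lastCoord x ≤ Real.exp n := hx.1.2
    have h2 : 0 < lastCoord x := lt_of_lt_of_le (Real.exp_pos _) hx.1.1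
    have h3 : ‖initCoord x‖ ≤ R := mem_closedBall_zero_iff.1 hx.2
    have h4 := Real.exp_pos n
    refine le_of_sq_le_sq ?_ (by positivity)
    rw [norm_sq_eq_lastCoord_add_initCoord]
    nlinarith [norm_nonneg (initCoord x)]
  have hKH : K ⊆ halfSpace (m + 1) := fun x hx => lt_of_lt_of_le (Real.exp_pos _) hx.1.1
  have hzero : ∀ x ∉ K, (extremal γ n R x : ℝ) = 0 := by
    intro x hx
    unfold extremal
    split_ifs with h0
    · by_contra hne
      apply hx
      have hc : cutoff n R x ≠ 0 := right_ne_zero_of_mul hne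
      have ha : ‖n⁻¹ • Real.log (lastCoord x)‖ < 1 := by
        by_contra h; exact left_ne_zero_of_mul hc (tent_eq_zero (not_lt.1 h))
      have hb : ‖R⁻¹ • initCoord x‖ < 1 := by
        by_contra h; exact right_ne_zero_of_mul hc (tent_eq_zero (not_lt.1 h))
      rw [norm_smul, Real.norm_of_nonneg (inv_pos.2 hn).le, ← div_eq_inv_mul, div_lt_one hn,
        Real.norm_eq_abs, abs_lt] at ha
      rw [norm_smul, Real.norm_of_nonneg (inv_pos.2 hR).le, ← div_eq_inv_mul, div_lt_one hR] at hb
      refine ⟨⟨?_, ?_⟩, mem_closedBall_zero_iff.2 hb.le⟩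
      · exact (Real.le_log_iff_exp_le h0).1 ha.1.le
      · exact (Real.log_le_iff_le_exp h0).1 ha.2.le
    · rfl
  have hHopen : IsOpen (halfSpace (m + 1)) := isOpen_lt continuous_const continuous_lastCoord
  refine ⟨continuous_iff_continuousAt.2 fun x => ?_, HasCompactSupport.intro hK hzero, ?_⟩
  · by_cases hx : x ∈ halfSpace (m + 1)
    · have hx' : 0 < lastCoord x := hx
      have hev : (extremal γ n R : EuclideanSpace ℝ (Fin (m + 1)) → ℝ) =ᶠ[nhds x]
          fun x => lastCoord x ^ (-γ) * (tent (n⁻¹ • Real.log (lastCoord x)) *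
            tent (R⁻¹ • initCoord x)) := by
        filter_upwards [hHopen.mem_nhds hx] with y hy
        exact if_pos hy
      refine ContinuousAt.congr ?_ hev.symm
      have hl : ContinuousAt (lastCoord : EuclideanSpace ℝ (Fin (m + 1)) → ℝ) x :=
        continuous_lastCoord.continuousAt
      refine (hl.rpow_const (Or.inl hx'.ne')).mul (ContinuousAt.mul ?_ ?_)
      · have hlog : ContinuousAt (fun y : EuclideanSpace ℝ (Fin (m + 1)) =>
            n⁻¹ * Real.log (lastCoord y)) x := continuousAt_const.mul (hl.log hx'.ne')
        exact ContinuousAt.comp (g := tent) continuous_tent.continuousAt hlog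
      · have hinit : Continuous fun y : EuclideanSpace ℝ (Fin (m + 1)) =>
            tent (R⁻¹ • initCoord y) := by fun_prop
        exact hinit.continuousAt
    · have hev : (extremal γ n R : EuclideanSpace ℝ (Fin (m + 1)) → ℝ) =ᶠ[nhds x] fun _ => 0 := by
        filter_upwards [hKclosed.isOpen_compl.mem_nhds fun h => hx (hKH h)] with y hy
        exact hzero y hy
      exact continuousAt_const.congr hev.symm
  · refine (closure_minimal ?_ hKclosed).trans hKH
    intro x hx
    by_contra h
    exact hx (hzero x h)

theorem rpow_mul_extremal {m : ℕ} {γ n R : ℝ} {x : EuclideanSpace ℝ (Fin (m + 1))}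
    (hx : 0 < lastCoord x) : lastCoord x ^ γ * extremal γ n R x = cutoff n R x := by
  rw [extremal, if_pos hx, ← mul_assoc, ← Real.rpow_add hx]
  simp

/-- The factor `‖η‖^q` replaces `σ` by `σ - q`. Then `σ < q` handles `η_d → 0`, `q < 1 + σ` makes
the integrals over the slices converge, and the two remaining hypotheses handle `η_d → 1`. -/
theorem lintegral_slab_error_ne_top {m : ℕ} {σ q ε α β : ℝ} (hσ0 : σ < q) (hσ1 : q < 1 + σ)
    (hα : -1 < α - ε * q) (hβ : -1 < β - ε * q) :
    ∫⁻ η in slab m, ENNReal.ofReal (‖η‖ ^ (-(((m + 1 : ℕ) : ℝ) + σ))) *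
      ENNReal.ofReal ((1 - lastCoord η) ^ α + (1 - lastCoord η) ^ β) *
      ENNReal.ofReal (((1 - lastCoord η) ^ (-ε) * ‖η‖) ^ q) ≠ ∞ := by
  have heq : ∫⁻ η in slab m, ENNReal.ofReal (‖η‖ ^ (-(((m + 1 : ℕ) : ℝ) + σ))) *
      ENNReal.ofReal ((1 - lastCoord η) ^ α + (1 - lastCoord η) ^ β) *
      ENNReal.ofReal (((1 - lastCoord η) ^ (-ε) * ‖η‖) ^ q) =
      ∫⁻ η in slab m, ENNReal.ofReal (‖η‖ ^ (-(((m + 1 : ℕ) : ℝ) + (σ - q)))) *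
      (fun r => ENNReal.ofReal ((1 - r) ^ (α - ε * q) + (1 - r) ^ (β - ε * q)))
        (lastCoord η) := by
    refine setLIntegral_congr_fun (measurableSet_slab m) fun η hη => ?_
    have ht : 0 < 1 - lastCoord η := by linarith [hη.2]
    have hηn := norm_pos_of_mem_slab hη
    simp only
    rw [← ENNReal.ofReal_mul (by positivity), ← ENNReal.ofReal_mul (by positivity),
      ← ENNReal.ofReal_mul (by positivity)]
    congr 1
    rw [Real.mul_rpow (by positivity) (by positivity), ← Real.rpow_mul ht.le,
      show -(((m + 1 : ℕ) : ℝ) + (σ - q)) = -(((m + 1 : ℕ) : ℝ) + σ) + q by ring,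
      Real.rpow_add hηn, Real.rpow_sub ht, Real.rpow_sub ht, neg_mul, Real.rpow_neg ht.le]
    field_simp
  rw [heq, setLIntegral_slab (σ := σ - q) (G := fun r =>
    ENNReal.ofReal ((1 - r) ^ (α - ε * q) + (1 - r) ^ (β - ε * q))) (by linarith) (by fun_prop)]
  refine ENNReal.mul_ne_top ENNReal.ofReal_ne_top ?_
  have h1 := intervalIntegrable_rpow_mul_one_sub_rpow (a := -(1 + (σ - q))) (by linarith) hα
  have h2 := intervalIntegrable_rpow_mul_one_sub_rpow (a := -(1 + (σ - q))) (by linarith) hβ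
  have h3 := h1.add h2
  rw [intervalIntegrable_iff_integrableOn_Ioo_of_le zero_le_one] at h3
  refine ne_of_lt (lt_of_le_of_lt (le_of_eq ?_) h3.lintegral_lt_top)
  refine setLIntegral_congr_fun measurableSet_Ioo fun r hr => ?_
  have hr0 := hr.1
  rw [← ENNReal.ofReal_mul (by positivity), mul_add]

theorem hardyIntegral_extremal {m : ℕ} {s p α β γ n R : ℝ} (hγ : γ * p = 1 + α + β - s * p)
    (hn : 0 < n) (hR : 0 < R) :
    hardyIntegral (m + 1) s p α β (extremal γ n R) =
      ∫⁻ x, ENNReal.ofReal (|cutoff n R x| ^ p) ∂halfMeasure m := by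
  rw [hardyIntegral_eq hγ (extremal_mem_Cc γ hn hR).1.measurable]
  refine lintegral_congr_ae ?_
  filter_upwards [ae_halfMeasure m] with x hx
  rw [rpow_mul_extremal hx]

theorem weightedEnergy_extremal {m : ℕ} {s p α β γ n R : ℝ} (hγ : γ * p = 1 + α + β - s * p)
    (hn : 0 < n) (hR : 0 < R) :
    weightedEnergy (m + 1) s p α β (extremal γ n R) =
      ∫⁻ η in slab m, ENNReal.ofReal (‖η‖ ^ (-(((m + 1 : ℕ) : ℝ) + s * p))) *
        ENNReal.ofReal ((1 - lastCoord η) ^ α + (1 - lastCoord η) ^ β) *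
        ∫⁻ x, ENNReal.ofReal (|cutoff n R x - (1 - lastCoord η) ^ (-γ) *
          cutoff n R (shear η x)| ^ p) ∂halfMeasure m := by
  rw [weightedEnergy_eq hγ (extremal_mem_Cc γ hn hR).1.measurable]
  refine setLIntegral_congr_fun (measurableSet_slab m) fun η hη => ?_
  have ht : 0 < 1 - lastCoord η := by linarith [hη.2]
  congr 1
  refine lintegral_congr_ae ?_
  filter_upwards [ae_halfMeasure m] with x hx
  rw [rpow_mul_extremal hx, rpow_mul_extremal (by rw [lastCoord_shear]; positivity)]

/-- Along the approximate extremals the Hardy quotient is almost the constant. -/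
theorem exists_weightedEnergy_extremal_le {m : ℕ} {s p α β γ : ℝ} (hs0 : 0 < s) (hs1 : s < 1)
    (hp : 1 ≤ p) (hα : -1 < α) (hβ : -1 < β) (hγ : γ * p = 1 + α + β - s * p)
    (hint : IntervalIntegrable (hardyConstIntegrand s p α β) volume 0 1) :
    ∃ q : ℝ, 0 < q ∧ ∃ M : ℝ≥0∞, M ≠ ∞ ∧ ∀ n θ : ℝ, 0 < n → 0 < θ → θ < 1 →
      weightedEnergy (m + 1) s p α β (extremal γ n (n * Real.exp n)) ≤
        (ENNReal.ofReal ((1 - θ) ^ (1 - p)) * ENNReal.ofReal (hardyConst (m + 1) s p α β) +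
          ENNReal.ofReal (θ ^ (1 - p)) * (M * ENNReal.ofReal (n ^ (-q)))) *
        hardyIntegral (m + 1) s p α β (extremal γ n (n * Real.exp n)) := by
  have hp0 : 0 < p := by linarith
  have hsp : 0 < s * p := mul_pos hs0 hp0
  -- `q > sp` makes the error integrable at `η = 0`; `q < p` is compatible with it because `s < 1`;
  -- `q < 1 + sp` is for the slices.
  obtain ⟨q, hq1, hq2⟩ : ∃ q, s * p < q ∧ q < min p (1 + s * p) :=
    exists_between (lt_min (by nlinarith) (by linarith))
  have hqp := hq2.trans_le (min_le_left _ _)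
  have hqs := hq2.trans_le (min_le_right _ _)
  have hq0 : 0 < q := hsp.trans hq1
  -- `ε` is small enough that `α - ε q` and `β - ε q` stay above `-1`.
  obtain ⟨ε, hε, hε'⟩ : ∃ ε, 0 < ε ∧ ε < min 1 ((1 + min α β) / q) :=
    exists_between (lt_min one_pos (div_pos (by have := lt_min hα hβ; linarith) hq0))
  have hε1 : ε ≤ 1 := (hε'.trans_le (min_le_left _ _)).le
  have hεq : ε * q < 1 + min α β := (lt_div_iff₀ hq0).1 (hε'.trans_le (min_le_right _ _))
  obtain ⟨C, hC, hbound⟩ := exists_lintegral_cutoff_sub_shear_le (m := m) hp hq0.le hqp.le hε hε1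
  have hK := lintegral_slab_error_ne_top (m := m) (ε := ε) (α := α) (β := β) hq1 hqs
    (by have := min_le_left α β; linarith) (by have := min_le_right α β; linarith)
  refine ⟨q, hq0, C * _, ENNReal.mul_ne_top hC hK, fun n θ hn hθ0 hθ1 => ?_⟩
  have hR : 0 < n * Real.exp n := mul_pos hn (Real.exp_pos n)
  have hbound := hbound n hn
  rw [weightedEnergy_extremal hγ hn hR, hardyIntegral_extremal hγ hn hR,
    ← setLIntegral_slab_hardyConstIntegrand (by linarith) hp0 hγ hint]
  set N := ∫⁻ x, ENNReal.ofReal (|cutoff n (n * Real.exp n) x| ^ p) ∂halfMeasure m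
  set a := ENNReal.ofReal ((1 - θ) ^ (1 - p))
  set b := ENNReal.ofReal (θ ^ (1 - p))
  calc _ ≤ ∫⁻ η in slab m, (a * N * (ENNReal.ofReal (‖η‖ ^ (-(((m + 1 : ℕ) : ℝ) + s * p))) *
            ENNReal.ofReal ((1 - lastCoord η) ^ α + (1 - lastCoord η) ^ β) *
            ENNReal.ofReal (|1 - (1 - lastCoord η) ^ (-γ)| ^ p)) +
          b * C * N * ENNReal.ofReal (n ^ (-q)) *
            (ENNReal.ofReal (‖η‖ ^ (-(((m + 1 : ℕ) : ℝ) + s * p))) *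
            ENNReal.ofReal ((1 - lastCoord η) ^ α + (1 - lastCoord η) ^ β) *
            ENNReal.ofReal (((1 - lastCoord η) ^ (-ε) * ‖η‖) ^ q))) := by
        refine setLIntegral_mono' (measurableSet_slab m) fun η hη => ?_
        have ht : 0 < 1 - lastCoord η := by linarith [hη.2]
        have hup := lintegral_sub_mul_comp_le (measurePreserving_shear hη) hp
          (Real.rpow_nonneg ht.le (-γ)) hθ0 hθ1 (measurable_cutoff n (n * Real.exp n))
        have hsplit : ENNReal.ofReal (((1 - lastCoord η) ^ (-ε) * ‖η‖ / n) ^ q) =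
            ENNReal.ofReal (n ^ (-q)) *
              ENNReal.ofReal (((1 - lastCoord η) ^ (-ε) * ‖η‖) ^ q) := by
          rw [← ENNReal.ofReal_mul (by positivity), Real.div_rpow (by positivity) hn.le,
            Real.rpow_neg hn.le, div_eq_inv_mul]
        have hd := hbound η hη
        rw [hsplit] at hd
        refine (mul_le_mul_right (hup.trans (add_le_add_right (mul_le_mul_right hd _) _)) _).trans
          (le_of_eq ?_)
        ring
    _ = _ := by
        rw [lintegral_add_left (by fun_prop), lintegral_const_mul _ (by fun_prop),
          lintegral_const_mul _ (by fun_prop)]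
        ring

/-- Optimality of the constant. -/
theorem le_hardyConst {m : ℕ} {s p α β : ℝ} (hs0 : 0 < s) (hs1 : s < 1) (hp : 1 ≤ p)
    (hα : -1 < α) (hβ : -1 < β)
    (hint : IntervalIntegrable (hardyConstIntegrand s p α β) volume 0 1)
    (hpos : 0 < hardyConst (m + 1) s p α β) {C : ℝ}
    (hC : ∀ u ∈ Cc (halfSpace (m + 1)), ENNReal.ofReal C * hardyIntegral (m + 1) s p α β u ≤
      weightedEnergy (m + 1) s p α β u) :
    C ≤ hardyConst (m + 1) s p α β := by
  have hp0 : 0 < p := by linarith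
  set γ := (1 + α + β - s * p) / p with hγ_def
  have hγ : γ * p = 1 + α + β - s * p := by rw [hγ_def]; field_simp
  obtain ⟨q, hq, M, hM, hle⟩ := exists_weightedEnergy_extremal_le (m := m) hs0 hs1 hp hα hβ hγ hint
  set D := hardyConst (m + 1) s p α β
  have h1 : ∀ n θ : ℝ, 0 < n → 0 < θ → θ < 1 → ENNReal.ofReal C ≤
      ENNReal.ofReal ((1 - θ) ^ (1 - p)) * ENNReal.ofReal D +
          ENNReal.ofReal (θ ^ (1 - p)) * (M * ENNReal.ofReal (n ^ (-q))) := by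
    intro n θ hn hθ0 hθ1
    have hR : 0 < n * Real.exp n := mul_pos hn (Real.exp_pos n)
    have hmem := extremal_mem_Cc (m := m) γ hn hR
    have h := (hC _ hmem).trans (hle n θ hn hθ0 hθ1)
    refine (ENNReal.mul_le_mul_iff_left ?_ (hardyIntegral_ne_top hp0 hmem)).1 h
    rw [hardyIntegral_extremal hγ hn hR, lintegral_cutoff hn hR]
    refine mul_ne_zero ?_ (mul_ne_zero (lintegral_tent_ne_zero hp0) (lintegral_tent_ne_zero hp0))
    rw [ne_eq, ENNReal.ofReal_eq_zero, not_le]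
    positivity
  -- Let `n → ∞` with `θ` fixed, since `θ^(1-p)` may blow up as `θ → 0`; only afterwards is `θ` sent
  -- to `0`.
  have h2 : ∀ θ : ℝ, 0 < θ → θ < 1 → ENNReal.ofReal C ≤
      ENNReal.ofReal ((1 - θ) ^ (1 - p)) * ENNReal.ofReal D := by
    intro θ hθ0 hθ1
    have hlim0 : Filter.Tendsto (fun n : ℝ => ENNReal.ofReal (n ^ (-q))) Filter.atTop (nhds 0) := by
      have := ENNReal.tendsto_ofReal (tendsto_rpow_neg_atTop hq)
      rwa [ENNReal.ofReal_zero] at this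
    have hlim := (ENNReal.Tendsto.const_mul (ENNReal.Tendsto.const_mul hlim0 (Or.inr hM))
      (Or.inr (ENNReal.ofReal_ne_top (r := θ ^ (1 - p))))).const_add
      (ENNReal.ofReal ((1 - θ) ^ (1 - p)) * ENNReal.ofReal D)
    rw [mul_zero, mul_zero, add_zero] at hlim
    refine ge_of_tendsto hlim ?_
    filter_upwards [Filter.eventually_gt_atTop 0] with n hn using h1 n θ hn hθ0 hθ1
  have h3 : ENNReal.ofReal C ≤ ENNReal.ofReal D := by
    have hc : ContinuousAt (fun θ : ℝ => (1 - θ) ^ (1 - p)) 0 :=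
      (continuousAt_const.sub continuousAt_id).rpow_const (Or.inl (by simp))
    have hlim : Filter.Tendsto (fun θ : ℝ => ENNReal.ofReal ((1 - θ) ^ (1 - p)) * ENNReal.ofReal D)
        (nhdsWithin 0 (Ioi 0)) (nhds (1 * ENNReal.ofReal D)) := by
      refine ENNReal.Tendsto.mul_const ?_ (Or.inr ENNReal.ofReal_ne_top)
      have := ENNReal.tendsto_ofReal (hc.tendsto.mono_left (nhdsWithin_le_nhds (s := Ioi 0)))
      simpa using this
    rw [one_mul] at hlim
    refine ge_of_tendsto hlim ?_
    filter_upwards [Ioo_mem_nhdsGT one_pos] with θ hθ using h2 θ hθ.1 hθ.2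
  -- `ENNReal.ofReal` truncates at `0`, so returning to real numbers relies on the nonnegativity of
  -- the constant.
  exact (ENNReal.ofReal_le_ofReal_iff hpos.le).1 h3

end

theorem theorem1p1 (d : ℕ) [NeZero d] (s p α β : ℝ)
    (hs0 : 0 < s) (hs1 : s < 1) (hp : 1 ≤ p)
    (hα : α ∈ Set.Ioo (-1) (s * p)) (hβ : β ∈ Set.Ioo (-1) (s * p))
    (hαβ : α + β ∈ Set.Ioo (-1) (s * p)) (hne : 1 + α + β ≠ s * p) :
    -- the integral defining the constant converges, and the constant is positive
    IntervalIntegrable (hardyConstIntegrand s p α β) volume 0 1 ∧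
    0 < hardyConst d s p α β ∧
    -- the inequality
    (∀ u ∈ Cc (halfSpace d),
      ENNReal.ofReal (hardyConst d s p α β) * hardyIntegral d s p α β u
        ≤ weightedEnergy d s p α β u) ∧
    -- optimality: no larger constant is admissible
    (∀ C : ℝ,
      (∀ u ∈ Cc (halfSpace d),
        ENNReal.ofReal C * hardyIntegral d s p α β u ≤ weightedEnergy d s p α β u) →
      C ≤ hardyConst d s p α β) := by
  obtain ⟨m, rfl⟩ : ∃ m, d = m + 1 := Nat.exists_eq_succ_of_ne_zero (NeZero.ne d)
  have hp0 : 0 < p := by linarith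
  have hsp : -1 < s * p := by linarith [mul_pos hs0 hp0]
  have hint := intervalIntegrable_hardyConstIntegrand hs1 hp hα hβ
  have hpos := hardyConst_pos (m := m) hp0 hsp hne hint
  exact ⟨hint, hpos, fun u hu => hardyConst_mul_hardyIntegral_le hsp hp hint hu,
    fun C hC => le_hardyConst hs0 hs1 hp hα.1 hβ.1 hint hpos hC⟩
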